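/- Let $X$ be a topological space. Let $PX$ be the space of all paths $\gamma:[0,1]\to X$ with the compact-open topology, and let $\pi:PX\to X\times X$, $\pi(\gamma)=(\gamma(0),\gamma(1))$. The group $\mathbb{Z}/2$ acts on $PX$ by reversing paths and on $X\times X$ by transposing coordinates. The symmetrized topological complexity $\mathsf{TC}^\Sigma(X)$ is the least integer $m\ge 0$ such that $X\times X$ has a cover by $\mathbb{Z}/2$-invariant open sets $U_0,\dots,U_m$, for each of which there is a continuous $\mathbb{Z}/2$-equivariant map $\sigma_i:U_i\to PX$ with $\pi\circ\sigma_i$ equal to the inclusion $U_i\hookrightarrow X\times X$; if there is no such $m$, then $\mathsf{TC}^\Sigma(X)=\infty$. Let $SP^2(X)=(X\times X)/(\mathbb{Z}/2)$ be the symmetric square with the quotient topology, and let $dX\subseteq SP^2(X)$ be the image of the diagonal of $X\times X$, with the subspace topology. **Theorem 3.4.** Let $R$ be any (associative, unital, not necessarily commutative) ring and let $H^*(-)=H^*(-;R)=\bigoplus_{n\ge 0}H^n(-;R)$ denote singular cohomology with coefficients in $R$, with the cup product. Suppose there are an integer $k\ge 0$ and classes $x_1,\dots,x_k\in H^*(SP^2(X))$,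 not necessarily homogeneous, such that 1. $x_i$ restricts to zero in $H^*(dX)$ for $i=1,\dots,k$; 2. $0\neq x_1\cdots x_k\in H^*(SP^2(X))$ (the empty product being $1$). Then $\mathsf{TC}^\Sigma(X)\ge k$. -/

import Mathlib

open CategoryTheory Simplicial Opposite

universe u v

noncomputable section

/-! ## The cohomology ring of a simplicial set with coefficients in a ring -/

/-- Families `f = (f₀, f₁, …)` of `R`-valued functions `fₙ` on the `n`-simplices of `S`. Functions
on the `n`-simplices with values in `R` are the same as homomorphisms to `R` from the free abelian
group of `n`-chains. -/
def CochainFamily (S : SSet.{u}) (R : Type v) : Type max u v :=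
  ∀ n : ℕ, S _⦋n⦌ → R

namespace CochainFamily

variable {S T : SSet.{u}} {R : Type v} [Ring R]

instance : AddCommGroup (CochainFamily S R) :=
  inferInstanceAs (AddCommGroup (∀ n : ℕ, S _⦋n⦌ → R))

/-- The cup product: `(f ⌣ g)(x) = ∑ₚ f(x|[0,…,p]) * g(x|[p,…,n])` for an `n`-simplex `x`. -/
instance : Mul (CochainFamily S R) where
  mul f g := fun n x => ∑ p : Fin (n + 1),
    f p (S.map (SimplexCategory.subinterval 0 p (by lia)).op x) *
      g (n - p) (S.map (SimplexCategory.subinterval p (n - p) (by lia)).op x)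

/-- The constant cochain `1` in degree `0`. -/
instance : One (CochainFamily S R) where
  one := fun n _ => if n = 0 then 1 else 0

/-- The coboundary: `(δf)(x) = ∑ᵢ (-1)ⁱ f(dᵢ x)` for an `(n+1)`-simplex `x`. -/
def coboundary (f : CochainFamily S R) : CochainFamily S R := fun n => match n with
  | 0 => fun _ => 0
  | n + 1 => fun x => ∑ i : Fin (n + 2), (-1) ^ (i : ℕ) * f n (S.δ i x)

/-- Pullback of cochains along a simplicial map. -/
def pullback (φ : S ⟶ T) (f : CochainFamily T R) : CochainFamily S R :=
  fun n x => f n (φ.app (op ⦋n⦌) x)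

/-- A family of cochains is finite if it vanishes in all large degrees, i.e. if it belongs to the
direct sum of the cochain groups of the various degrees. -/
def IsFinite (f : CochainFamily S R) : Prop :=
  ∃ N : ℕ, ∀ n, N ≤ n → ∀ x, f n x = 0

/-- `f` evaluated on the face `[a, …, a + b]` of `x`, or zero if there is no such face. -/
def ev (f : CochainFamily S R) {n : ℕ} (x : S _⦋n⦌) (a b : ℕ) : R :=
  if h : a + b ≤ n then f b (S.map (SimplexCategory.subinterval a b h).op x) else 0

set_option linter.unusedSectionVars false in
@[ext] lemma ext {f g : CochainFamily S R} (h : ∀ n x, f n x = g n x) : f = g :=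
  funext fun n => funext fun x => h n x

lemma add_apply (f g : CochainFamily S R) (n : ℕ) (x : S _⦋n⦌) : (f + g) n x = f n x + g n x := rfl
lemma neg_apply (f : CochainFamily S R) (n : ℕ) (x : S _⦋n⦌) : (-f) n x = -f n x := rfl
lemma zero_apply (n : ℕ) (x : S _⦋n⦌) : (0 : CochainFamily S R) n x = 0 := rfl
lemma one_apply (n : ℕ) (x : S _⦋n⦌) :
    (1 : CochainFamily S R) n x = if n = 0 then 1 else 0 := rfl

lemma ev_of_le (f : CochainFamily S R) {n : ℕ} (x : S _⦋n⦌) {a b : ℕ} (h : a + b ≤ n) :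
    ev f x a b = f b (S.map (SimplexCategory.subinterval a b h).op x) := dif_pos h

lemma subinterval_self (n : ℕ) (h : 0 + n ≤ n) :
    SimplexCategory.subinterval 0 n h = 𝟙 ⦋n⦌ := by
  ext i
  simp [SimplexCategory.subinterval]

lemma ev_self (f : CochainFamily S R) {n : ℕ} (x : S _⦋n⦌) : ev f x 0 n = f n x := by
  rw [ev_of_le f x (by lia), subinterval_self]
  simp

lemma ev_ev (f : CochainFamily S R) {n : ℕ} (x : S _⦋n⦌) {a b c d : ℕ} (h : a + b ≤ n)
    (h' : c + d ≤ b) :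
    ev f (S.map (SimplexCategory.subinterval a b h).op x) c d = ev f x (a + c) d := by
  rw [ev_of_le f _ h', ev_of_le f x (by lia), ← Functor.map_comp_apply, ← op_comp]
  have : SimplexCategory.subinterval c d h' ≫ SimplexCategory.subinterval a b h =
      SimplexCategory.subinterval (a + c) d (by lia) := by
    ext i
    change (i : ℕ) + c + a = i + (a + c)
    lia
  rw [this]

lemma mul_apply (f g : CochainFamily S R) (n : ℕ) (x : S _⦋n⦌) :
    (f * g) n x = ∑ p ∈ Finset.HasAntidiagonal.antidiagonal n, ev f x 0 p.1 * ev g x p.1 p.2 := by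
  rw [Finset.Nat.sum_antidiagonal_eq_sum_range_succ_mk, Finset.sum_range]
  refine Finset.sum_congr rfl fun p _ => ?_
  rw [ev_of_le f x (by lia), ev_of_le g x (by lia)]

lemma ev_mul (f g : CochainFamily S R) {n : ℕ} (x : S _⦋n⦌) {a b : ℕ} (h : a + b ≤ n) :
    ev (f * g) x a b =
      ∑ p ∈ Finset.HasAntidiagonal.antidiagonal b, ev f x a p.1 * ev g x (a + p.1) p.2 := by
  rw [ev_of_le _ x h, mul_apply]
  refine Finset.sum_congr rfl fun p hp => ?_
  rw [Finset.HasAntidiagonal.mem_antidiagonal] at hp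
  rw [ev_ev f x h (by lia), ev_ev g x h (by lia), add_zero]

lemma ev_add (f g : CochainFamily S R) {n : ℕ} (x : S _⦋n⦌) (a b : ℕ) :
    ev (f + g) x a b = ev f x a b + ev g x a b := by
  unfold ev; split_ifs <;> simp [add_apply]

lemma ev_zero {n : ℕ} (x : S _⦋n⦌) (a b : ℕ) : ev (0 : CochainFamily S R) x a b = 0 := by
  unfold ev; split_ifs <;> simp [zero_apply]

instance : Ring (CochainFamily S R) :=
  { (inferInstance : AddCommGroup (CochainFamily S R)),
    (inferInstance : Mul (CochainFamily S R)),
    (inferInstance : One (CochainFamily S R)) with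
    left_distrib := fun f g h => by
      ext n x
      simp only [mul_apply, add_apply, ev_add, mul_add, Finset.sum_add_distrib]
    right_distrib := fun f g h => by
      ext n x
      simp only [mul_apply, add_apply, ev_add, add_mul, Finset.sum_add_distrib]
    zero_mul := fun f => by
      ext n x
      simp only [mul_apply, ev_zero, zero_mul, Finset.sum_const_zero, zero_apply]
    mul_zero := fun f => by
      ext n x
      simp only [mul_apply, ev_zero, mul_zero, Finset.sum_const_zero, zero_apply]
    one_mul := fun f => by
      ext n x
      rw [mul_apply, Finset.sum_eq_single (0, n)]
      · rw [ev_of_le _ x (by simp), ev_self]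
        simp [one_apply]
      · rintro ⟨p, q⟩ hp hne
        rw [Finset.HasAntidiagonal.mem_antidiagonal] at hp
        dsimp only at hp ⊢
        have : p ≠ 0 := by
          rintro rfl
          exact hne (by simp [← hp])
        rw [ev_of_le _ x (by lia), one_apply, if_neg this, zero_mul]
      · simp
    mul_one := fun f => by
      ext n x
      rw [mul_apply, Finset.sum_eq_single (n, 0)]
      · rw [ev_of_le _ x (show n + 0 ≤ n by simp), ev_self]
        simp [one_apply]
      · rintro ⟨p, q⟩ hp hne
        rw [Finset.HasAntidiagonal.mem_antidiagonal] at hp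
        dsimp only at hp ⊢
        have : q ≠ 0 := by
          rintro rfl
          exact hne (by simp [← hp])
        rw [ev_of_le (1 : CochainFamily S R) x (by lia), one_apply, if_neg this, mul_zero]
      · simp
    mul_assoc := fun f g h => by
      ext n x
      rw [mul_apply, mul_apply]
      have h1 : ∀ p ∈ Finset.HasAntidiagonal.antidiagonal n, ev (f * g) x 0 p.1 * ev h x p.1 p.2 =
          ∑ q ∈ Finset.HasAntidiagonal.antidiagonal p.1,
            ev f x 0 q.1 * ev g x q.1 q.2 * ev h x (q.1 + q.2) p.2 := by
        intro p hp
        rw [Finset.HasAntidiagonal.mem_antidiagonal] at hp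
        rw [ev_mul f g x (by lia), Finset.sum_mul]
        refine Finset.sum_congr rfl fun q hq => ?_
        rw [Finset.HasAntidiagonal.mem_antidiagonal] at hq
        rw [zero_add, hq]
      have h2 : ∀ p ∈ Finset.HasAntidiagonal.antidiagonal n, ev f x 0 p.1 * ev (g * h) x p.1 p.2 =
          ∑ q ∈ Finset.HasAntidiagonal.antidiagonal p.2,
            ev f x 0 p.1 * ev g x p.1 q.1 * ev h x (p.1 + q.1) q.2 := by
        intro p hp
        rw [Finset.HasAntidiagonal.mem_antidiagonal] at hp
        rw [ev_mul g h x (by lia), Finset.mul_sum]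
        refine Finset.sum_congr rfl fun q hq => ?_
        rw [mul_assoc]
      rw [Finset.sum_congr rfl h1, Finset.sum_congr rfl h2]
      simp only [Finset.sum_sigma']
      apply Finset.sum_nbij' (fun ⟨⟨_i, j⟩, ⟨k, l⟩⟩ => ⟨(k, l + j), (l, j)⟩)
        (fun ⟨⟨i, _j⟩, ⟨k, l⟩⟩ => ⟨(i + k, l), (i, k)⟩) <;>
        simp +contextual only [Finset.mem_sigma, Finset.HasAntidiagonal.mem_antidiagonal,
          Sigma.forall, Prod.forall, and_imp] <;> grind
    zsmul := fun z f => z • f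
    nsmul := fun z f => z • f }

/-- The sign involution: multiplication by `(-1)ⁿ` in degree `n`. -/
def sign (f : CochainFamily S R) : CochainFamily S R := fun n x => (-1) ^ n * f n x

lemma coboundary_zero_apply (f : CochainFamily S R) (x : S _⦋0⦌) : coboundary f 0 x = 0 := rfl
lemma coboundary_succ_apply (f : CochainFamily S R) (n : ℕ) (x : S _⦋n + 1⦌) :
    coboundary f (n + 1) x = ∑ i : Fin (n + 2), (-1) ^ (i : ℕ) * f n (S.δ i x) := rfl

lemma coboundary_add (f g : CochainFamily S R) :
    coboundary (f + g) = coboundary f + coboundary g := by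
  ext n x
  cases n with
  | zero => simp [coboundary_zero_apply, add_apply]
  | succ n => simp [coboundary_succ_apply, add_apply, mul_add, Finset.sum_add_distrib]

lemma coboundary_neg (f : CochainFamily S R) : coboundary (-f) = -coboundary f := by
  ext n x
  cases n with
  | zero => simp [coboundary_zero_apply, neg_apply]
  | succ n => simp [coboundary_succ_apply, neg_apply]

lemma coboundary_zero : coboundary (0 : CochainFamily S R) = 0 := by
  ext n x
  cases n with
  | zero => simp [coboundary_zero_apply, zero_apply]
  | succ n => simp [coboundary_succ_apply, zero_apply]

lemma coboundary_one : coboundary (1 : CochainFamily S R) = 0 := by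
  ext n x
  cases n with
  | zero => simp [coboundary_zero_apply, zero_apply]
  | succ n =>
    cases n with
    | zero => simp [coboundary_succ_apply, one_apply, zero_apply, Fin.sum_univ_succ]
    | succ n => simp [coboundary_succ_apply, one_apply, zero_apply]

lemma sign_sign (f : CochainFamily S R) : sign (sign f) = f := by
  ext n x
  rcases neg_one_pow_eq_or R n with h | h <;> simp [sign, h]

lemma coboundary_sign (f : CochainFamily S R) : coboundary (sign f) = -sign (coboundary f) := by
  ext n x
  cases n with
  | zero => simp [coboundary_zero_apply, neg_apply, sign]
  | succ n =>
    simp only [coboundary_succ_apply, neg_apply, sign, Finset.mul_sum, ← Finset.sum_neg_distrib]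
    refine Finset.sum_congr rfl fun i _ => ?_
    rcases neg_one_pow_eq_or R n with h | h <;> rcases neg_one_pow_eq_or R (i : ℕ) with h' | h' <;>
      simp [h, h', pow_succ]

lemma ev_face_left (f : CochainFamily S R) {n : ℕ} (x : S _⦋n + 1⦌) {a b : ℕ} (i : Fin (n + 2))
    (h : a + b < (i : ℕ)) : ev f (S.δ i x) a b = ev f x a b := by
  rw [ev_of_le f _ (by lia), ev_of_le f x (by lia), SimplicialObject.δ, ← Functor.map_comp_apply,
    ← op_comp]
  have : SimplexCategory.subinterval a b (by lia) ≫ SimplexCategory.δ i =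
      SimplexCategory.subinterval a b (by lia) := by
    ext j
    change ((i.succAbove ⟨j + a, _⟩ : Fin (n + 2)) : ℕ) = j + a
    rw [Fin.succAbove_of_castSucc_lt]
    · rfl
    · have := j.2
      simp only [SimplexCategory.len_mk] at this
      rw [Fin.lt_def]
      simp only [Fin.val_castSucc]
      lia
  rw [this]

lemma ev_face_right (f : CochainFamily S R) {n : ℕ} (x : S _⦋n + 1⦌) {a b : ℕ} (i : Fin (n + 2))
    (hab : a + b ≤ n) (h : (i : ℕ) ≤ a) : ev f (S.δ i x) a b = ev f x (a + 1) b := by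
  rw [ev_of_le f _ hab, ev_of_le f x (by lia), SimplicialObject.δ, ← Functor.map_comp_apply,
    ← op_comp]
  have : SimplexCategory.subinterval a b (by lia) ≫ SimplexCategory.δ i =
      SimplexCategory.subinterval (a + 1) b (by lia) := by
    ext j
    change ((i.succAbove ⟨j + a, _⟩ : Fin (n + 2)) : ℕ) = j + (a + 1)
    rw [Fin.succAbove_of_le_castSucc]
    · simp; lia
    · rw [Fin.le_def]
      simp only [Fin.val_castSucc]
      lia
  rw [this]

lemma ev_face_mid (f : CochainFamily S R) {n : ℕ} (x : S _⦋n + 1⦌) {a b : ℕ} (i : Fin (n + 2))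
    (hab : a + b ≤ n) (j : Fin (b + 2)) (h : (i : ℕ) = a + j) :
    ev f (S.δ i x) a b =
      f b (S.δ j (S.map (SimplexCategory.subinterval a (b + 1) (by lia)).op x)) := by
  rw [ev_of_le f _ hab, SimplicialObject.δ, SimplicialObject.δ, ← Functor.map_comp_apply,
    ← op_comp, ← Functor.map_comp_apply, ← op_comp]
  have : SimplexCategory.subinterval a b (by lia) ≫ SimplexCategory.δ i =
      SimplexCategory.δ j ≫ SimplexCategory.subinterval a (b + 1) (by lia) := by
    ext k
    change ((i.succAbove ⟨k + a, _⟩ : Fin (n + 2)) : ℕ) = ((j.succAbove k : Fin (b + 2)) : ℕ) + a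
    by_cases hk : (k : ℕ) < j
    · rw [Fin.succAbove_of_castSucc_lt, Fin.succAbove_of_castSucc_lt]
      · simp
      · rw [Fin.lt_def]; simpa using hk
      · rw [Fin.lt_def]; simp only [Fin.val_castSucc]; lia
    · rw [Fin.succAbove_of_le_castSucc, Fin.succAbove_of_le_castSucc]
      · simp; lia
      · rw [Fin.le_def]; simpa using hk
      · rw [Fin.le_def]; simp only [Fin.val_castSucc]; lia
  rw [this]

/-- The Leibniz rule on the summand of bidegree `(p, q)`. -/
lemma leibniz_aux (f g : CochainFamily S R) {n p q : ℕ} (h : p + q = n) (x : S _⦋n + 1⦌) :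
    ∑ i : Fin (n + 2), (-1) ^ (i : ℕ) * (ev f (S.δ i x) 0 p * ev g (S.δ i x) p q) =
      ev (coboundary f) x 0 (p + 1) * ev g x (p + 1) q +
        ev (sign f) x 0 p * ev (coboundary g) x p (q + 1) := by
  subst h
  have e1 : ev (coboundary f) x 0 (p + 1) = (∑ i : Fin (p + 1), (-1) ^ (i : ℕ) *
      f p (S.δ i.castSucc (S.map (SimplexCategory.subinterval 0 (p + 1) (by lia)).op x))) +
      (-1) ^ (p + 1) * ev f x 0 p := by
    rw [ev_of_le _ x (by lia), coboundary_succ_apply, Fin.sum_univ_castSucc]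
    congr 2
    rw [← ev_self f (S.δ _ _), ev_face_left f _ _ (by simp), ev_ev f x _ (by lia)]
  have e2 : ev (coboundary g) x p (q + 1) = ev g x (p + 1) q + ∑ j : Fin (q + 1),
      (-1) ^ ((j : ℕ) + 1) *
      g q (S.δ j.succ (S.map (SimplexCategory.subinterval p (q + 1) (by lia)).op x)) := by
    rw [ev_of_le _ x (by lia), coboundary_succ_apply, Fin.sum_univ_succ]
    congr 1
    rw [← ev_self g (S.δ _ _), ev_face_right g _ _ (by simp) (by simp), ev_ev g x _ (by lia)]
    simp
  have e3 : ev (sign f) x 0 p = (-1) ^ p * ev f x 0 p := by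
    rw [ev_of_le _ x (by lia), ev_of_le _ x (by lia)]; rfl
  rw [e1, e2, e3, ← (finCongr (show (p + 1) + (q + 1) = p + q + 2 by lia)).sum_comp,
    Fin.sum_univ_add]
  have s1 : ∀ i : Fin (p + 1), (-1) ^ ((finCongr (show (p + 1) + (q + 1) = p + q + 2 by lia)
      (Fin.castAdd (q + 1) i) : Fin (p + q + 2)) : ℕ) *
      (ev f (S.δ (finCongr (show (p + 1) + (q + 1) = p + q + 2 by lia)
        (Fin.castAdd (q + 1) i)) x) 0 p *
       ev g (S.δ (finCongr (show (p + 1) + (q + 1) = p + q + 2 by lia)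
        (Fin.castAdd (q + 1) i)) x) p q) =
      (-1) ^ (i : ℕ) * f p (S.δ i.castSucc
        (S.map (SimplexCategory.subinterval 0 (p + 1) (by lia)).op x)) * ev g x (p + 1) q := by
    intro i
    rw [ev_face_mid f x _ (by lia) i.castSucc (by simp),
      ev_face_right g x _ le_rfl (by simp; lia), ← mul_assoc]
    simp
  have s2 : ∀ j : Fin (q + 1), (-1) ^ ((finCongr (show (p + 1) + (q + 1) = p + q + 2 by lia)
      (Fin.natAdd (p + 1) j) : Fin (p + q + 2)) : ℕ) *
      (ev f (S.δ (finCongr (show (p + 1) + (q + 1) = p + q + 2 by lia)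
        (Fin.natAdd (p + 1) j)) x) 0 p *
       ev g (S.δ (finCongr (show (p + 1) + (q + 1) = p + q + 2 by lia)
        (Fin.natAdd (p + 1) j)) x) p q) =
      (-1) ^ p * ev f x 0 p * ((-1) ^ ((j : ℕ) + 1) * g q (S.δ j.succ
        (S.map (SimplexCategory.subinterval p (q + 1) (by lia)).op x))) := by
    intro j
    rw [ev_face_left f x _ (by simp; lia),
      ev_face_mid g x _ le_rfl j.succ (by simp; lia)]
    simp only [finCongr_apply, Fin.val_cast, Fin.val_natAdd]
    rw [show p + 1 + (j : ℕ) = p + (j + 1) by lia, pow_add (-1 : R) p, mul_assoc, mul_assoc,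
      ← mul_assoc _ (ev f x 0 p), ((Commute.neg_one_left (ev f x 0 p)).pow_left _).eq, mul_assoc]
  rw [Finset.sum_congr rfl fun i _ => s1 i, Finset.sum_congr rfl fun j _ => s2 j,
    ← Finset.sum_mul, ← Finset.mul_sum, add_mul, mul_add]
  rw [pow_succ]
  noncomm_ring

/-- The Leibniz rule `δ(f ⌣ g) = δf ⌣ g + (-1)^{deg f} f ⌣ δg`. -/
lemma coboundary_mul (f g : CochainFamily S R) :
    coboundary (f * g) = coboundary f * g + sign f * coboundary g := by
  ext n x
  cases n with
  | zero =>
    rw [add_apply, mul_apply, mul_apply]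
    simp [ev_of_le, coboundary]
  | succ n =>
    rw [coboundary_succ_apply, add_apply, mul_apply, mul_apply,
      Finset.Nat.sum_antidiagonal_succ, Finset.Nat.sum_antidiagonal_succ']
    have z1 : ev (coboundary f) x 0 0 = 0 := by
      rw [ev_of_le _ x (by lia), coboundary_zero_apply]
    have z2 : ev (coboundary g) x (n + 1) 0 = 0 := by
      rw [ev_of_le _ x (by lia), coboundary_zero_apply]
    rw [z1, z2, zero_mul, mul_zero, zero_add, zero_add, ← Finset.sum_add_distrib]
    simp only [mul_apply, Finset.mul_sum]
    rw [Finset.sum_comm]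
    refine Finset.sum_congr rfl fun p hp => ?_
    exact leibniz_aux f g (Finset.HasAntidiagonal.mem_antidiagonal.1 hp) x

lemma IsFinite.zero : IsFinite (0 : CochainFamily S R) := ⟨0, fun _ _ _ => rfl⟩

lemma IsFinite.one : IsFinite (1 : CochainFamily S R) :=
  ⟨1, fun n hn x => by rw [one_apply, if_neg (by lia)]⟩

lemma IsFinite.add {f g : CochainFamily S R} (hf : IsFinite f) (hg : IsFinite g) :
    IsFinite (f + g) := by
  obtain ⟨N, hN⟩ := hf
  obtain ⟨M, hM⟩ := hg
  exact ⟨N + M, fun n hn x => by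
    rw [add_apply, hN n (by lia), hM n (by lia), add_zero]⟩

lemma IsFinite.neg {f : CochainFamily S R} (hf : IsFinite f) : IsFinite (-f) := by
  obtain ⟨N, hN⟩ := hf
  exact ⟨N, fun n hn x => by rw [neg_apply, hN n hn, neg_zero]⟩

lemma IsFinite.sign {f : CochainFamily S R} (hf : IsFinite f) : IsFinite (sign f) := by
  obtain ⟨N, hN⟩ := hf
  exact ⟨N, fun n hn x => by rw [CochainFamily.sign, hN n hn, mul_zero]⟩

lemma IsFinite.mul {f g : CochainFamily S R} (hf : IsFinite f) (hg : IsFinite g) :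
    IsFinite (f * g) := by
  obtain ⟨N, hN⟩ := hf
  obtain ⟨M, hM⟩ := hg
  refine ⟨N + M, fun n hn x => ?_⟩
  rw [mul_apply]
  refine Finset.sum_eq_zero fun p hp => ?_
  rw [Finset.HasAntidiagonal.mem_antidiagonal] at hp
  rw [ev_of_le f x (by lia), ev_of_le g x (by lia)]
  rcases le_or_gt N p.1 with h | h
  · rw [hN _ h, zero_mul]
  · rw [hM p.2 (by lia), mul_zero]

lemma IsFinite.pullback (φ : S ⟶ T) {f : CochainFamily T R} (hf : IsFinite f) :
    IsFinite (pullback φ f) := by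
  obtain ⟨N, hN⟩ := hf
  exact ⟨N, fun n hn x => hN n hn _⟩

lemma ev_pullback (φ : S ⟶ T) (f : CochainFamily T R) {n : ℕ} (x : S _⦋n⦌) (a b : ℕ) :
    ev (pullback φ f) x a b = ev f (φ.app (op ⦋n⦌) x) a b := by
  unfold ev
  split_ifs with h
  · rw [pullback, NatTrans.naturality_apply]
  · rfl

lemma pullback_mul (φ : S ⟶ T) (f g : CochainFamily T R) :
    pullback φ (f * g) = pullback φ f * pullback φ g := by
  ext n x
  rw [pullback, mul_apply, mul_apply]
  simp only [ev_pullback]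

lemma pullback_coboundary (φ : S ⟶ T) (f : CochainFamily T R) :
    pullback φ (coboundary f) = coboundary (pullback φ f) := by
  ext n x
  cases n with
  | zero => rfl
  | succ n =>
    rw [pullback, coboundary_succ_apply, coboundary_succ_apply]
    refine Finset.sum_congr rfl fun i _ => ?_
    rw [pullback, SimplicialObject.δ, SimplicialObject.δ, NatTrans.naturality_apply]

variable (S R) in
/-- The ring of cocycles: the elements of the direct sum of all cochain groups that are killed by
the coboundary. -/
def cocycles : Subring (CochainFamily S R) where
  carrier := {f | IsFinite f ∧ coboundary f = 0}
  zero_mem' := ⟨.zero, coboundary_zero⟩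
  one_mem' := ⟨.one, coboundary_one⟩
  add_mem' hf hg := ⟨hf.1.add hg.1, by rw [coboundary_add, hf.2, hg.2, add_zero]⟩
  neg_mem' hf := ⟨hf.1.neg, by rw [coboundary_neg, hf.2, neg_zero]⟩
  mul_mem' hf hg := ⟨hf.1.mul hg.1, by
    rw [coboundary_mul, hf.2, hg.2, zero_mul, mul_zero, add_zero]⟩

variable (S R) in
/-- The ideal of coboundaries in the ring of cocycles. -/
def coboundaries : Ideal (cocycles S R) where
  carrier := {z | ∃ g : CochainFamily S R, IsFinite g ∧ coboundary g = z}
  zero_mem' := ⟨0, .zero, coboundary_zero⟩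
  add_mem' := by
    rintro _ _ ⟨f, hf, hf'⟩ ⟨g, hg, hg'⟩
    exact ⟨f + g, hf.add hg, by rw [coboundary_add, hf', hg']; rfl⟩
  smul_mem' := by
    rintro z _ ⟨g, hg, hg'⟩
    refine ⟨sign z.1 * g, z.2.1.sign.mul hg, ?_⟩
    have : sign (0 : CochainFamily S R) = 0 := by ext n x; simp [sign, zero_apply]
    rw [coboundary_mul, coboundary_sign, z.2.2, sign_sign, hg', this, neg_zero, zero_mul, zero_add]
    rfl

instance : (coboundaries S R).IsTwoSided where
  mul_mem_of_left := by
    rintro _ z ⟨g, hg, hg'⟩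
    refine ⟨g * z.1, hg.mul z.2.1, ?_⟩
    rw [coboundary_mul, z.2.2, mul_zero, add_zero, hg']
    rfl

/-- Pullback of cocycles along a simplicial map. -/
def cocyclesMap (φ : S ⟶ T) : cocycles T R →+* cocycles S R where
  toFun z := ⟨pullback φ z.1, z.2.1.pullback φ, by
    rw [← pullback_coboundary, z.2.2]; rfl⟩
  map_zero' := rfl
  map_one' := rfl
  map_add' _ _ := rfl
  map_mul' _ _ := Subtype.ext (pullback_mul φ _ _)

end CochainFamily

/-- The cohomology ring `H^*(S; R) = ⨁ₙ Hⁿ(S; R)` of a simplicial set, cocycles modulo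
coboundaries, with the cup product. -/
abbrev SimplicialCohomology (S : SSet.{u}) (R : Type v) [Ring R] : Type max u v :=
  CochainFamily.cocycles S R ⧸ CochainFamily.coboundaries S R

/-- The ring homomorphism in cohomology induced by a simplicial map. -/
def SimplicialCohomology.map {S T : SSet.{u}} (R : Type v) [Ring R] (φ : S ⟶ T) :
    SimplicialCohomology T R →+* SimplicialCohomology S R :=
  Ideal.quotientMap _ (CochainFamily.cocyclesMap φ) (by
    rintro _ ⟨g, hg, hg'⟩
    exact ⟨CochainFamily.pullback φ g, hg.pullback φ, by
      rw [← CochainFamily.pullback_coboundary, hg']; rfl⟩)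

/-! ## Singular cohomology -/

/-- The singular cohomology ring `H^*(Y; R)` of a topological space `Y`, i.e. the cohomology ring
of its singular simplicial set. -/
abbrev SingularCohomology (Y : Type u) [TopologicalSpace Y] (R : Type v) [Ring R] : Type max u v :=
  SimplicialCohomology (TopCat.toSSet.obj (TopCat.of Y)) R

/-- The ring homomorphism `f^* : H^*(Z; R) → H^*(Y; R)` induced by a continuous map. -/
def SingularCohomology.map {Y Z : Type u} [TopologicalSpace Y] [TopologicalSpace Z]
    (R : Type v) [Ring R] (f : C(Y, Z)) : SingularCohomology Z R →+* SingularCohomology Y R :=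
  SimplicialCohomology.map R (TopCat.toSSet.map (TopCat.ofHom f))

/-- The restriction `H^*(Y; R) → H^*(A; R)` to a subspace `A` of `Y`. -/
def SingularCohomology.restrict {Y : Type u} [TopologicalSpace Y] (A : Set Y)
    (R : Type v) [Ring R] : SingularCohomology Y R →+* SingularCohomology A R :=
  SingularCohomology.map R ⟨Subtype.val, continuous_subtype_val⟩

/-! ## The symmetric square -/

/-- The symmetric square `SP²(X)`: the orbit space of the involution `(x, y) ↦ (y, x)` on
`X × X`, with the quotient topology. -/
def SymmetricSquare (X : Type u) : Type u := Quot (fun p q : X × X => q = p.swap)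

namespace SymmetricSquare

variable (X : Type u)

/-- The orbit projection `ρ : X × X → SP²(X)`. -/
def proj (p : X × X) : SymmetricSquare X := Quot.mk _ p

instance [TopologicalSpace X] : TopologicalSpace (SymmetricSquare X) :=
  TopologicalSpace.coinduced (proj X) inferInstance

/-- The subspace `dX` of `SP²(X)`: the image of the diagonal of `X × X`. -/
def diagonal : Set (SymmetricSquare X) := proj X '' Set.diagonal X

end SymmetricSquare

/-! ## Symmetrized topological complexity -/

/-- `U ⊆ X × X` carries a local `ℤ/2`-section of the path fibration
`π : PX → X × X, γ ↦ (γ 0, γ 1)`, where `PX` is the space of all paths with the compact-open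
topology: a continuous `σ : U → PX` such that `σ(x, y)` is a path from `x` to `y` and such that
`σ(y, x)` is the reverse of the path `σ(x, y)`. -/
def HasEquivariantSection {X : Type u} [TopologicalSpace X] (U : Set (X × X)) : Prop :=
  ∃ σ : C(U, C(unitInterval, X)),
    (∀ p : U, (σ p 0, σ p 1) = (p : X × X)) ∧
    ∀ p q : U, (q : X × X) = (p : X × X).swap → ∀ t, σ q t = σ p (unitInterval.symm t)

/-- `X × X` has a cover `U₀, …, U_m` by open sets that are invariant under the transposition of
coordinates and carry local `ℤ/2`-sections of the path fibration. -/
def HasSymmetrizedMotionPlanner (X : Type u) [TopologicalSpace X] (m : ℕ) : Prop :=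
  ∃ U : Fin (m + 1) → Set (X × X),
    (∀ i, IsOpen (U i)) ∧ (∀ i, Prod.swap ⁻¹' U i = U i) ∧ (⋃ i, U i) = Set.univ ∧
      ∀ i, HasEquivariantSection (U i)

/-- The symmetrized topological complexity `TC^Σ(X)`: the least `m` for which there is such a cover
`U₀, …, U_m`, and `∞` if there is none. -/
def symmetrizedTC (X : Type u) [TopologicalSpace X] : ℕ∞ :=
  ⨅ (m : ℕ) (_ : HasSymmetrizedMotionPlanner X m), (m : ℕ∞)

end

noncomputable section

/-! Suppose invariant open sets `U 0, …, U m` with equivariant sections cover `X × X` and `m < k`.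
Their images `V i` form an open cover of the symmetric square. Over `V i`, move the two points of an
unordered pair along the chosen path from its two ends until they meet at the midpoint. Equivariance
makes this independent of the order of the pair, so the inclusion of `V i` is homotopic to a map
into the diagonal (`exists_homotopic_diagonal`). By homotopy invariance every `x i` restricts to
zero on every `V j`. As there are at least `m + 1` classes, the cup-length principle
(`list_prod_eq_zero_of_restrict_eq_zero`) makes their product vanish.

The principle is proved on cochains, without relative cohomology. A class that dies on `A` has a
representing cocycle that is zero on all simplices in `A`. The product of such representatives is
zero on every simplex lying in some member of the cover, and
`exists_coboundary_eq_of_vanishesOn_cover` shows by barycentric subdivision that such a cocycle is a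
coboundary.

Both the prism operator and subdivision involve only affine simplices, which are determined by their
tuples of vertices. They are therefore built as operators on functions of tuples, where coning
contracts the complex, and carried to singular cochains by evaluating at the vertices of the
standard simplex. Naturality in the vertex set gives compatibility with faces. -/

/-! ## Cochains on tuples -/

/-- `A`-valued functions on the `n`-tuples of elements of `K`. These are the cochains of degree
`n - 1` in the augmented cochain complex of the full simplex with vertex set `K`. -/
abbrev TupleCochain (K : Type*) (A : Type*) (n : ℕ) := (Fin n → K) → A

namespace TupleCochain

variable {K K' L L' A : Type*} [AddCommGroup A]

/-- The coboundary `(δf)(v) = ∑ᵢ (-1)ⁱ f(v₀, …, v̂ᵢ, …, vₙ)`. -/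
def delta {n : ℕ} : TupleCochain K A n →+ TupleCochain K A (n + 1) :=
  AddMonoidHom.pi fun v => ∑ i : Fin (n + 1),
    (-1 : ℤ) ^ (i : ℕ) • Pi.evalAddMonoidHom (fun _ : Fin n → K => A) (v ∘ i.succAbove)

/-- The operator dual to taking the cone with apex `b`: `(cone b f)(v) = f(b, v₀, …, vₙ)`. -/
def cone {n : ℕ} (b : K) : TupleCochain K A (n + 1) →+ TupleCochain K A n :=
  AddMonoidHom.pi fun v =>
    Pi.evalAddMonoidHom (fun _ : Fin (n + 1) → K => A) (Fin.cons b v : Fin (n + 1) → K)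

/-- Pullback along a map of vertex sets. -/
def comap {n : ℕ} (α : K → L) : TupleCochain L A n →+ TupleCochain K A n :=
  AddMonoidHom.pi fun v => Pi.evalAddMonoidHom (fun _ : Fin n → L => A) (α ∘ v)

lemma delta_apply {n : ℕ} (f : TupleCochain K A n) (v : Fin (n + 1) → K) :
    delta f v = ∑ i : Fin (n + 1), (-1 : ℤ) ^ (i : ℕ) • f (v ∘ i.succAbove) := by
  simp [delta, AddMonoidHom.pi]

lemma cone_apply {n : ℕ} (b : K) (f : TupleCochain K A (n + 1)) (v : Fin n → K) :
    cone b f v = f (Fin.cons b v : Fin (n + 1) → K) := rfl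

lemma comap_apply {n : ℕ} (α : K → L) (f : TupleCochain L A n) (v : Fin n → K) :
    comap α f v = f (α ∘ v) := rfl

/-- Together with `cone_delta`, this says that `cone b` contracts the augmented complex: a full
simplex is a cone with apex at any of its vertices. Face `0` of a cone is its base, and the other
faces are cones on the faces of the base. -/
lemma cone_delta_zero (b : K) (f : TupleCochain K A 0) : cone b (delta f) = f := by
  funext v
  rw [cone_apply, delta_apply]
  simp [Subsingleton.elim _ v]

lemma cone_delta {n : ℕ} (b : K) (f : TupleCochain K A (n + 1)) :
    cone b (delta f) = f - delta (cone b f) := by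
  funext v
  rw [cone_apply, delta_apply, Fin.sum_univ_succ, Pi.sub_apply, delta_apply, sub_eq_add_neg,
    ← Finset.sum_neg_distrib]
  congr 1
  · simp only [Fin.val_zero, pow_zero, one_smul]
    rfl
  · refine Finset.sum_congr rfl fun i _ => ?_
    rw [cone_apply, Fin.val_succ, pow_succ, mul_neg_one, neg_smul]
    congr 3
    funext j
    refine Fin.cases ?_ (fun j => ?_) j <;> simp

/-- A cochain is zero at `v` if its cone with apex `v 0` is zero at the tail of `v`. Moving that
cone past both coboundaries with `cone_delta` reduces the degree, so no cancellation in a double sum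
is needed. -/
lemma delta_delta {n : ℕ} (f : TupleCochain K A n) : delta (delta f) = 0 := by
  have key : ∀ v : Fin (n + 2) → K, cone (v 0) (delta (delta f)) (Fin.tail v) = 0 →
      delta (delta f) v = 0 := fun v h => by
    rwa [cone_apply, Fin.cons_self_tail] at h
  induction n with
  | zero =>
    funext v
    apply key
    rw [cone_delta, cone_delta_zero, sub_self]
    rfl
  | succ n ih =>
    funext v
    apply key
    rw [cone_delta, cone_delta, map_sub, sub_sub_cancel, ih]
    · rfl
    · exact fun v h => by rwa [cone_apply, Fin.cons_self_tail] at h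

lemma delta_comap {n : ℕ} (α : K → L) (f : TupleCochain L A n) :
    delta (comap α f) = comap α (delta f) := by
  funext v
  simp only [delta_apply, comap_apply]
  rfl

lemma cone_comap {n : ℕ} (α : K → L) (b : K) (f : TupleCochain L A (n + 1)) :
    cone b (comap α f) = comap α (cone (α b) f) := by
  funext v
  simp only [cone_apply, comap_apply]
  congr 1
  funext j
  refine Fin.cases ?_ (fun j => ?_) j <;> simp

/-! ### Chain homotopies -/

/-- The operator dual to the chain homotopy between two augmentation preserving chain maps
`φ` and `ψ`, given on tuples by `P(v) = a(v) * (φ(v) - ψ(v) - P(∂v))`, where `*` is the cone with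
given apex. -/
def homotopy (a : ∀ n, (Fin (n + 1) → K) → K')
    (φ ψ : ∀ n, TupleCochain K' A n →+ TupleCochain K A n) (n : ℕ) :
    TupleCochain K' A (n + 1) →+ TupleCochain K A n := match n with
  | 0 => 0
  | n + 1 => AddMonoidHom.pi fun v =>
      ((Pi.evalAddMonoidHom (fun _ : Fin (n + 1) → K => A) v).comp
        (φ (n + 1) - ψ (n + 1) - delta.comp (homotopy a φ ψ n))).comp (cone (a n v))

section

variable (a : ∀ n, (Fin (n + 1) → K) → K')
  (φ ψ : ∀ n, TupleCochain K' A n →+ TupleCochain K A n)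

lemma homotopy_zero (f : TupleCochain K' A 1) : homotopy a φ ψ 0 f = 0 := rfl

lemma homotopy_succ {n : ℕ} (f : TupleCochain K' A (n + 2)) (v : Fin (n + 1) → K) :
    homotopy a φ ψ (n + 1) f v = φ (n + 1) (cone (a n v) f) v - ψ (n + 1) (cone (a n v) f) v -
      delta (homotopy a φ ψ n (cone (a n v) f)) v := rfl

variable {φ ψ}

/-- Acyclic models in explicit form. At a fixed `v` the apex is fixed, and `cone_delta` splits the
coned coboundary into `f` and the coboundary of the cone of `f`. The operator `φ - ψ - δP` kills the
second part, by the previous degree and because `φ` and `ψ` commute with `delta`. -/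
lemma homotopy_delta (hφ : ∀ n (f : TupleCochain K' A n), φ (n + 1) (delta f) = delta (φ n f))
    (hψ : ∀ n (f : TupleCochain K' A n), ψ (n + 1) (delta f) = delta (ψ n f))
    (h0 : φ 0 = ψ 0) (n : ℕ) (f : TupleCochain K' A (n + 1)) :
    homotopy a φ ψ (n + 1) (delta f) =
      φ (n + 1) f - ψ (n + 1) f - delta (homotopy a φ ψ n f) := by
  have key : ∀ (n : ℕ) (g : TupleCochain K' A n),
      delta (homotopy a φ ψ n (delta g)) = delta (φ n g) - delta (ψ n g) →
      φ (n + 1) (delta g) - ψ (n + 1) (delta g) - delta (homotopy a φ ψ n (delta g)) = 0 := by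
    intro n g h
    rw [h, hφ, hψ, sub_self]
  induction n with
  | zero =>
    funext v
    have := congrFun (key 0 (cone (a 0 v) f) (by simp [homotopy_zero, h0])) v
    rw [homotopy_succ, cone_delta]
    simp only [map_sub, Pi.sub_apply, Pi.zero_apply] at this ⊢
    refine sub_eq_zero.1 (neg_eq_zero.1 (Eq.trans ?_ this))
    abel
  | succ n ih =>
    funext v
    have := congrFun (key (n + 1) (cone (a (n + 1) v) f) (by
      rw [ih, map_sub, map_sub, delta_delta, sub_zero])) v
    rw [homotopy_succ, cone_delta]
    simp only [map_sub, Pi.sub_apply, Pi.zero_apply] at this ⊢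
    refine sub_eq_zero.1 (neg_eq_zero.1 (Eq.trans ?_ this))
    abel

end

/-- The rule for the apex is the only choice made in `homotopy`, so a natural rule gives a natural
operator. This is the source of all compatibility with faces of singular simplices. -/
lemma homotopy_comap {a : ∀ n, (Fin (n + 1) → K) → K'} {b : ∀ n, (Fin (n + 1) → L) → L'}
    {φ ψ : ∀ n, TupleCochain K' A n →+ TupleCochain K A n}
    {φ' ψ' : ∀ n, TupleCochain L' A n →+ TupleCochain L A n} (α : K → L) (β : K' → L')
    (hab : ∀ n v, β (a n v) = b n (α ∘ v))
    (hφ : ∀ n (f : TupleCochain L' A n), φ n (comap β f) = comap α (φ' n f))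
    (hψ : ∀ n (f : TupleCochain L' A n), ψ n (comap β f) = comap α (ψ' n f))
    (n : ℕ) (f : TupleCochain L' A (n + 1)) :
    homotopy a φ ψ n (comap β f) = comap α (homotopy b φ' ψ' n f) := by
  induction n with
  | zero => rfl
  | succ n ih =>
    funext v
    rw [homotopy_succ, cone_comap, hφ, hψ, ih, hab, delta_comap]
    rfl

/-! ### Subdivision -/

/-- The operator dual to the subdivision operator `S(v) = b(v) * S(∂v)`. -/
def subdivision (b : ∀ n, (Fin (n + 1) → K) → K) (n : ℕ) :
    TupleCochain K A n →+ TupleCochain K A n := match n with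
  | 0 => AddMonoidHom.id _
  | n + 1 => AddMonoidHom.pi fun v =>
      ((Pi.evalAddMonoidHom (fun _ : Fin (n + 1) → K => A) v).comp
        (delta.comp (subdivision b n))).comp (cone (b n v))

lemma subdivision_zero (b : ∀ n, (Fin (n + 1) → K) → K) (f : TupleCochain K A 0) :
    subdivision b 0 f = f := rfl

lemma subdivision_succ (b : ∀ n, (Fin (n + 1) → K) → K) {n : ℕ} (f : TupleCochain K A (n + 1))
    (v : Fin (n + 1) → K) :
    subdivision b (n + 1) f v = delta (subdivision b n (cone (b n v) f)) v := rfl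

lemma subdivision_delta (b : ∀ n, (Fin (n + 1) → K) → K) (n : ℕ) (f : TupleCochain K A n) :
    subdivision b (n + 1) (delta f) = delta (subdivision b n f) := by
  induction n with
  | zero =>
    funext v
    rw [subdivision_succ, cone_delta_zero]
  | succ n ih =>
    funext v
    rw [subdivision_succ, cone_delta, map_sub, map_sub, ih, delta_delta, sub_zero]

lemma subdivision_comap {b : ∀ n, (Fin (n + 1) → K) → K} {b' : ∀ n, (Fin (n + 1) → L) → L}
    (α : K → L) (hα : ∀ n v, α (b n v) = b' n (α ∘ v)) (n : ℕ) (f : TupleCochain L A n) :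
    subdivision b n (comap α f) = comap α (subdivision b' n f) := by
  induction n with
  | zero => rfl
  | succ n ih =>
    funext v
    rw [subdivision_succ, cone_comap, ih, hα, delta_comap]
    rfl

lemma iterate_subdivision_delta (b : ∀ n, (Fin (n + 1) → K) → K) (n j : ℕ)
    (f : TupleCochain K A n) :
    (subdivision b (n + 1))^[j] (delta f) = delta ((subdivision b n)^[j] f) := by
  induction j generalizing f with
  | zero => rfl
  | succ j ih => rw [Function.iterate_succ_apply, subdivision_delta, ih]; rfl

lemma iterate_subdivision_comap {b : ∀ n, (Fin (n + 1) → K) → K}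
    {b' : ∀ n, (Fin (n + 1) → L) → L} (α : K → L) (hα : ∀ n v, α (b n v) = b' n (α ∘ v)) (n j : ℕ)
    (f : TupleCochain L A n) :
    (subdivision b n)^[j] (comap α f) = comap α ((subdivision b' n)^[j] f) := by
  induction j generalizing f with
  | zero => rfl
  | succ j ih => rw [Function.iterate_succ_apply, subdivision_comap α hα, ih]; rfl

/-- The operator dual to the chain homotopy between the identity and the subdivision operator. -/
def subdivisionHomotopy (b : ∀ n, (Fin (n + 1) → K) → K) (n : ℕ) :
    TupleCochain K A (n + 1) →+ TupleCochain K A n :=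
  homotopy b (fun _ => AddMonoidHom.id _) (subdivision b) n

lemma subdivisionHomotopy_delta (b : ∀ n, (Fin (n + 1) → K) → K) (n : ℕ)
    (f : TupleCochain K A (n + 1)) :
    subdivisionHomotopy b (n + 1) (delta f) =
      f - subdivision b (n + 1) f - delta (subdivisionHomotopy b n f) :=
  homotopy_delta b (φ := fun _ => AddMonoidHom.id _) (fun _ _ => rfl) (subdivision_delta b) rfl n f

lemma subdivisionHomotopy_comap {b : ∀ n, (Fin (n + 1) → K) → K}
    {b' : ∀ n, (Fin (n + 1) → L) → L} (α : K → L) (hα : ∀ n v, α (b n v) = b' n (α ∘ v)) (n : ℕ)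
    (f : TupleCochain L A (n + 1)) :
    subdivisionHomotopy b n (comap α f) = comap α (subdivisionHomotopy b' n f) :=
  homotopy_comap α α hα (fun _ _ => rfl) (subdivision_comap α hα) n f

/-- The sum of the homotopies from the identity to the iterated subdivision. -/
lemma delta_sum_iterate_subdivisionHomotopy (b : ∀ n, (Fin (n + 1) → K) → K) (n : ℕ)
    (f : TupleCochain K A (n + 1)) (hf : delta f = 0) (N : ℕ) :
    delta (∑ j ∈ Finset.range N, (subdivision b n)^[j] (subdivisionHomotopy b n f)) =
      f - (subdivision b (n + 1))^[N] f := by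
  have h1 : delta (subdivisionHomotopy b n f) = f - subdivision b (n + 1) f := by
    have := subdivisionHomotopy_delta b n f
    rw [hf, map_zero] at this
    exact (sub_eq_zero.1 this.symm).symm
  induction N with
  | zero => simp
  | succ N ih =>
    -- The sum telescopes: the term with index `N` has coboundary equal to the `N`-th iterate minus
    -- the next.
    rw [Finset.sum_range_succ, map_add, ih, ← iterate_subdivision_delta, h1, iterate_map_sub,
      Function.iterate_succ_apply]
    abel

/-! ### Subdivision makes tuples small -/

section Metric

variable [PseudoMetricSpace K] {b : ∀ n, (Fin (n + 1) → K) → K}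

/-- Only tuples of the subdivision of `v` enter. The condition that every closed ball around `v`
also contains `w` stands in for `w` lying in the convex hull of `v`, and so makes sense for any apex
rule in a metric space. -/
lemma subdivision_eq_zero
    (hb : ∀ n (v : Fin (n + 1) → K) (x : K) (r : ℝ), (∀ i, dist x (v i) ≤ r) → dist x (b n v) ≤ r)
    (hb' : ∀ n (v : Fin (n + 1) → K) (D : ℝ), (∀ i j, dist (v i) (v j) ≤ D) →
      ∀ i, dist (b n v) (v i) ≤ n / (n + 1) * D)
    (n : ℕ) (f : TupleCochain K A (n + 1)) (v : Fin (n + 1) → K) (D : ℝ)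
    (hv : ∀ i j, dist (v i) (v j) ≤ D)
    (hf : ∀ w : Fin (n + 1) → K,
      (∀ x r, (∀ i, dist x (v i) ≤ r) → ∀ i, dist x (w i) ≤ r) →
      (∀ i j, dist (w i) (w j) ≤ n / (n + 1) * D) → f w = 0) :
    subdivision b (n + 1) f v = 0 := by
  have hD : 0 ≤ D := dist_nonneg.trans (hv 0 0)
  rw [subdivision_succ, delta_apply]
  refine Finset.sum_eq_zero fun i _ => ?_
  rw [smul_eq_zero_of_right]
  induction n with
  | zero =>
    rw [subdivision_zero, cone_apply]
    apply hf
    · intro x r hx i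
      rw [Subsingleton.elim (α := Fin 1) i 0, Fin.cons_zero]
      exact hb _ _ _ _ hx
    · intro i j
      rw [Subsingleton.elim (α := Fin 1) i j]
      simp
  | succ n ih =>
    have hcons : ∀ w : Fin (n + 1) → K,
        (∀ x r, (∀ k, dist x ((v ∘ i.succAbove) k) ≤ r) → ∀ k, dist x (w k) ≤ r) →
        (∀ k l, dist (w k) (w l) ≤ n / (n + 1) * D) → cone (b (n + 1) v) f w = 0 := by
      intro w hw hw'
      have hle : (n : ℝ) / (n + 1) ≤ ((n + 1 : ℕ) : ℝ) / ((n + 1 : ℕ) + 1) := by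
        rw [div_le_div_iff₀ (by positivity) (by positivity)]
        push_cast
        nlinarith
      -- The ball condition with centre the apex itself: the ball holding the vertices of the face
      -- holds `w` too.
      have hbw : ∀ k, dist (b (n + 1) v) (w k) ≤ ((n + 1 : ℕ) : ℝ) / ((n + 1 : ℕ) + 1) * D :=
        hw _ _ fun k => hb' (n + 1) v D hv _
      rw [cone_apply]
      apply hf
      · intro x r hx k
        refine Fin.cases ?_ (fun k => ?_) k
        · exact hb _ _ _ _ hx
        · exact hw x r (fun _ => hx _) k
      · intro k l
        refine Fin.cases ?_ (fun k => ?_) k <;> refine Fin.cases ?_ (fun l => ?_) l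
        · simp only [dist_self]; positivity
        · exact hbw l
        · rw [dist_comm]; exact hbw k
        · exact (hw' k l).trans (mul_le_mul_of_nonneg_right hle hD)
    rw [subdivision_succ, delta_apply]
    refine Finset.sum_eq_zero fun j _ => ?_
    rw [ih _ (v ∘ i.succAbove) (fun _ _ => hv _ _) hcons, smul_zero]
    exact Finset.mem_univ j

lemma iterate_subdivision_eq_zero
    (hb : ∀ n (v : Fin (n + 1) → K) (x : K) (r : ℝ), (∀ i, dist x (v i) ≤ r) → dist x (b n v) ≤ r)
    (hb' : ∀ n (v : Fin (n + 1) → K) (D : ℝ), (∀ i j, dist (v i) (v j) ≤ D) →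
      ∀ i, dist (b n v) (v i) ≤ n / (n + 1) * D)
    (n j : ℕ) (D : ℝ) (f : TupleCochain K A (n + 1))
    (hf : ∀ w : Fin (n + 1) → K, (∀ i k, dist (w i) (w k) ≤ ((n : ℝ) / (n + 1)) ^ j * D) → f w = 0)
    (v : Fin (n + 1) → K) (hv : ∀ i k, dist (v i) (v k) ≤ D) :
    (subdivision b (n + 1))^[j] f v = 0 := by
  induction j generalizing f with
  | zero => exact hf v (by simpa using hv)
  | succ j ih =>
    rw [Function.iterate_succ_apply]
    refine ih _ fun w hw => subdivision_eq_zero hb hb' n f w _ hw fun u _ hu => hf u ?_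
    simpa only [pow_succ', mul_assoc] using hu

lemma eventually_iterate_subdivision_eq_zero
    (hb : ∀ n (v : Fin (n + 1) → K) (x : K) (r : ℝ), (∀ i, dist x (v i) ≤ r) → dist x (b n v) ≤ r)
    (hb' : ∀ n (v : Fin (n + 1) → K) (D : ℝ), (∀ i j, dist (v i) (v j) ≤ D) →
      ∀ i, dist (b n v) (v i) ≤ n / (n + 1) * D)
    (n : ℕ) {ε : ℝ} (hε : 0 < ε) (f : TupleCochain K A (n + 1))
    (hf : ∀ w : Fin (n + 1) → K, (∀ i k, dist (w i) (w k) < ε) → f w = 0)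
    (v : Fin (n + 1) → K) :
    ∀ᶠ j in Filter.atTop, (subdivision b (n + 1))^[j] f v = 0 := by
  -- Any bound on the diameter of `v` will do, since the factor `n / (n + 1)` is less than `1`.
  set D : ℝ := ∑ i, ∑ k, dist (v i) (v k) with hD
  have hv : ∀ i k, dist (v i) (v k) ≤ D := fun i k =>
    (Finset.single_le_sum (f := fun k => dist (v i) (v k)) (fun _ _ => dist_nonneg)
      (Finset.mem_univ k)).trans
    (Finset.single_le_sum (f := fun i => ∑ k, dist (v i) (v k))
      (fun _ _ => Finset.sum_nonneg fun _ _ => dist_nonneg) (Finset.mem_univ i))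
  have ht : Filter.Tendsto (fun j : ℕ => ((n : ℝ) / (n + 1)) ^ j * D) Filter.atTop (nhds (0 * D)) :=
    (tendsto_pow_atTop_nhds_zero_of_lt_one (by positivity)
      ((div_lt_one (by positivity)).2 (lt_add_one _))).mul_const D
  rw [zero_mul] at ht
  filter_upwards [ht.eventually_lt_const hε] with j hj
  exact iterate_subdivision_eq_zero hb hb' n j D f
    (fun w hw => hf w fun i k => (hw i k).trans_lt hj) v hv

end Metric

end TupleCochain

/-! ## Affine simplices -/

/-- The affine map from the standard simplex to a convex set with given images of the vertices. -/
def affineSimplex {E : Type*} [NormedAddCommGroup E] [NormedSpace ℝ E] {C : Set E}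
    (hC : Convex ℝ C) {n : ℕ} (v : Fin (n + 1) → C) : C(stdSimplex ℝ (Fin (n + 1)), C) where
  toFun t := ⟨∑ i, t.1 i • (v i : E),
    hC.sum_mem (fun i _ => t.2.1 i) t.2.2 fun i _ => (v i).2⟩
  continuous_toFun := by
    refine Continuous.subtype_mk (continuous_finsetSum _ fun i _ => ?_) _
    exact ((continuous_apply i).comp continuous_subtype_val).smul continuous_const

namespace stdSimplex

/-- The vertices of the standard simplex. -/
def vertices (n : ℕ) (i : Fin (n + 1)) : stdSimplex ℝ (Fin (n + 1)) :=
  ⟨Pi.single i 1, single_mem_stdSimplex ℝ i⟩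

/-- The barycenter of the standard simplex. -/
def center (n : ℕ) : stdSimplex ℝ (Fin (n + 1)) :=
  ⟨fun _ => ((n : ℝ) + 1)⁻¹, fun _ => by positivity, by simp; field_simp⟩

/-- The map of standard simplices induced by a map of their vertices, as a continuous map. -/
def continuousMap {n m : ℕ} (f : Fin (n + 1) → Fin (m + 1)) :
    C(stdSimplex ℝ (Fin (n + 1)), stdSimplex ℝ (Fin (m + 1))) :=
  ⟨_, stdSimplex.continuous_map f⟩

end stdSimplex

open stdSimplex

section affineSimplex

variable {E : Type*} [NormedAddCommGroup E] [NormedSpace ℝ E] {C : Set E} (hC : Convex ℝ C)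

lemma coe_affineSimplex {n : ℕ} (v : Fin (n + 1) → C) (t : stdSimplex ℝ (Fin (n + 1))) :
    (affineSimplex hC v t : E) = ∑ i, t.1 i • (v i : E) := rfl

lemma affineSimplex_vertices {n : ℕ} (v : Fin (n + 1) → C) (i : Fin (n + 1)) :
    affineSimplex hC v (vertices n i) = v i := by
  apply Subtype.ext
  rw [coe_affineSimplex, Finset.sum_eq_single i]
  · simp [vertices]
  · intro j _ hj
    simp [vertices, hj]
  · simp

lemma affineSimplex_comp_affineSimplex {n m : ℕ} (v : Fin (n + 1) → C)
    (u : Fin (m + 1) → stdSimplex ℝ (Fin (n + 1))) :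
    (affineSimplex hC v).comp (affineSimplex (convex_stdSimplex ℝ _) u) =
      affineSimplex hC (affineSimplex hC v ∘ u) := by
  ext t
  simp only [ContinuousMap.comp_apply, coe_affineSimplex, Function.comp_apply, Finset.sum_apply,
    Pi.smul_apply, Finset.sum_smul, Finset.smul_sum, smul_eq_mul, mul_smul]
  rw [Finset.sum_comm]

lemma affineSimplex_vertices_eq_id (n : ℕ) :
    affineSimplex (convex_stdSimplex ℝ _) (vertices n) = ContinuousMap.id _ := by
  refine ContinuousMap.ext fun t => Subtype.ext (funext fun i => ?_)
  rw [coe_affineSimplex, Finset.sum_apply, Finset.sum_eq_single i]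
  · simp [vertices]
  · intro j _ hj
    simp [vertices, hj.symm]
  · simp

lemma affineSimplex_vertices_comp {n m : ℕ} (f : Fin (n + 1) → Fin (m + 1)) :
    affineSimplex (convex_stdSimplex ℝ _) (vertices m ∘ f) = continuousMap f := by
  refine ContinuousMap.ext fun t => Subtype.ext (funext fun i => ?_)
  rw [coe_affineSimplex, Finset.sum_apply]
  change _ = FunOnFinite.linearMap ℝ ℝ f t.1 i
  rw [FunOnFinite.linearMap_apply_apply, Finset.sum_filter]
  refine Finset.sum_congr rfl fun j _ => ?_
  simp [vertices, Pi.single_apply, eq_comm]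

lemma affineSimplex_comp_continuousMap {n m : ℕ} (v : Fin (m + 1) → C)
    (f : Fin (n + 1) → Fin (m + 1)) :
    (affineSimplex hC v).comp (continuousMap f) = affineSimplex hC (v ∘ f) := by
  rw [← affineSimplex_vertices_comp, affineSimplex_comp_affineSimplex]
  congr 1
  funext i
  exact affineSimplex_vertices hC v (f i)

lemma affineSimplex_const {n : ℕ} (c : C) (t : stdSimplex ℝ (Fin (n + 1))) :
    affineSimplex hC (fun _ => c) t = c := by
  apply Subtype.ext
  rw [coe_affineSimplex, ← Finset.sum_smul, t.2.2, one_smul]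

/-- The barycenter of a tuple of points in a convex set. -/
def barycenter (n : ℕ) (v : Fin (n + 1) → C) : C := affineSimplex hC v (center n)

/-- Affine maps preserve barycenters; this is the naturality that `subdivision_comap` and
`subdivisionHomotopy_comap` require of the apex. -/
lemma affineSimplex_barycenter {n m : ℕ} (v : Fin (n + 1) → C)
    (u : Fin (m + 1) → stdSimplex ℝ (Fin (n + 1))) :
    affineSimplex hC v (barycenter (convex_stdSimplex ℝ _) m u) =
      barycenter hC m (affineSimplex hC v ∘ u) :=
  DFunLike.congr_fun (affineSimplex_comp_affineSimplex hC v u) (center m)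

lemma dist_affineSimplex_le {n : ℕ} (v : Fin (n + 1) → C) (t : stdSimplex ℝ (Fin (n + 1))) (x : C)
    (r : ℝ) (h : ∀ i, dist x (v i) ≤ r) : dist x (affineSimplex hC v t) ≤ r := by
  rw [dist_comm]
  refine (convex_closedBall (x : E) r).sum_mem (fun i _ => t.2.1 i) t.2.2 fun i _ => ?_
  rw [Metric.mem_closedBall, dist_comm]
  exact h i

/-- The barycenter minus `v i` is the sum of the `n` differences `v j - v i` with `j ≠ i`, divided
by `n + 1`. -/
lemma dist_barycenter_le (n : ℕ) (v : Fin (n + 1) → C) (D : ℝ)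
    (h : ∀ i j, dist (v i) (v j) ≤ D) (i : Fin (n + 1)) :
    dist (barycenter hC n v) (v i) ≤ n / (n + 1) * D := by
  have h1 : (barycenter hC n v : E) - v i =
      ((n : ℝ) + 1)⁻¹ • ∑ j ∈ Finset.univ.erase i, ((v j : E) - v i) := by
    rw [Finset.sum_erase _ (sub_self _), Finset.sum_sub_distrib, smul_sub, Finset.smul_sum]
    simp only [Finset.sum_const, Finset.card_univ, Fintype.card_fin]
    rw [← Nat.cast_smul_eq_nsmul ℝ, smul_smul]
    push_cast
    rw [inv_mul_cancel₀ (by positivity), one_smul]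
    rfl
  rw [Subtype.dist_eq, dist_eq_norm, h1, norm_smul, norm_inv, Real.norm_of_nonneg (by positivity),
    div_mul_eq_mul_div, div_eq_inv_mul]
  refine mul_le_mul_of_nonneg_left ?_ (by positivity)
  refine (norm_sum_le_of_le _ (f := fun j => (v j : E) - v i) (n := fun _ => D)
    fun j _ => ?_).trans ?_
  · rw [← dist_eq_norm]
    exact h j i
  · simp

lemma continuousMap_comp_vertices {n m : ℕ} (f : Fin (n + 1) → Fin (m + 1)) :
    continuousMap f ∘ vertices n = vertices m ∘ f := by
  funext j
  rw [← affineSimplex_vertices_comp]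
  exact affineSimplex_vertices _ _ j

end affineSimplex

/-! ## Singular simplices -/

section singularSimplex

variable {X Y : Type u} [TopologicalSpace X] [TopologicalSpace Y] {R : Type v} [Ring R]

/-- The singular simplex, as a simplex of the singular simplicial set, given by a continuous map. -/
def singularSimplex {n : ℕ} (σ : C(stdSimplex ℝ (Fin (n + 1)), X)) :
    (TopCat.toSSet.obj (TopCat.of X)) _⦋n⦌ :=
  (TopCat.toSSetObjEquiv (TopCat.of X) (op ⦋n⦌)).symm σ

lemma exists_singularSimplex {n : ℕ} (x : (TopCat.toSSet.obj (TopCat.of X)) _⦋n⦌) :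
    ∃ σ : C(stdSimplex ℝ (Fin (n + 1)), X), x = singularSimplex σ :=
  ⟨TopCat.toSSetObjEquiv _ _ x, ((TopCat.toSSetObjEquiv _ _).symm_apply_apply x).symm⟩

lemma map_singularSimplex {n m : ℕ} (f : ⦋n⦌ ⟶ ⦋m⦌) (σ : C(stdSimplex ℝ (Fin (m + 1)), X)) :
    (TopCat.toSSet.obj (TopCat.of X)).map f.op (singularSimplex σ) =
      singularSimplex (σ.comp (continuousMap f)) := rfl

lemma δ_singularSimplex {n : ℕ} (i : Fin (n + 2)) (σ : C(stdSimplex ℝ (Fin (n + 1 + 1)), X)) :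
    (TopCat.toSSet.obj (TopCat.of X)).δ i (singularSimplex σ) =
      singularSimplex (σ.comp (continuousMap i.succAbove)) := rfl

lemma coboundary_singularSimplex (z : CochainFamily (TopCat.toSSet.obj (TopCat.of X)) R) (n : ℕ)
    (σ : C(stdSimplex ℝ (Fin (n + 1 + 1)), X)) :
    CochainFamily.coboundary z (n + 1) (singularSimplex σ) = ∑ i : Fin (n + 2),
      (-1 : ℤ) ^ (i : ℕ) • z n (singularSimplex (σ.comp (continuousMap i.succAbove))) := by
  rw [CochainFamily.coboundary_succ_apply]
  refine Finset.sum_congr rfl fun i _ => ?_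
  rw [δ_singularSimplex, zsmul_eq_mul]
  push_cast
  rfl

/-- The cochains given by functions on the continuous maps from the standard simplices. -/
def CochainFamily.ofContinuousMap (w : ∀ n, C(stdSimplex ℝ (Fin (n + 1)), X) → R) :
    CochainFamily (TopCat.toSSet.obj (TopCat.of X)) R :=
  fun n x => w n (TopCat.toSSetObjEquiv (TopCat.of X) (op ⦋n⦌) x)

set_option linter.unusedSectionVars false in
lemma CochainFamily.ofContinuousMap_singularSimplex
    (w : ∀ n, C(stdSimplex ℝ (Fin (n + 1)), X) → R) (n : ℕ)
    (σ : C(stdSimplex ℝ (Fin (n + 1)), X)) :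
    ofContinuousMap w n (singularSimplex σ) = w n σ :=
  congrArg (w n) ((TopCat.toSSetObjEquiv (TopCat.of X) (op ⦋n⦌)).apply_symm_apply σ)

lemma CochainFamily.isFinite_ofContinuousMap {w : ∀ n, C(stdSimplex ℝ (Fin (n + 1)), X) → R}
    (N : ℕ) (hw : ∀ n, N ≤ n → ∀ σ, w n σ = 0) : IsFinite (ofContinuousMap w) :=
  ⟨N, fun n hn _ => hw n hn _⟩

/-- The pullback of a cochain along a family of singular simplices indexed by tuples. -/
def CochainFamily.onTuples {K : Type*} (z : CochainFamily (TopCat.toSSet.obj (TopCat.of X)) R)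
    (s : ∀ n, (Fin (n + 1) → K) → C(stdSimplex ℝ (Fin (n + 1)), X)) (n : ℕ) :
    TupleCochain K R (n + 1) := fun v => z n (singularSimplex (s n v))

lemma CochainFamily.delta_onTuples {K : Type*}
    (z : CochainFamily (TopCat.toSSet.obj (TopCat.of X)) R)
    {s : ∀ n, (Fin (n + 1) → K) → C(stdSimplex ℝ (Fin (n + 1)), X)}
    (hs : ∀ n v (i : Fin (n + 2)), s n (v ∘ i.succAbove) =
      (s (n + 1) v).comp (continuousMap i.succAbove)) (n : ℕ) :
    TupleCochain.delta (z.onTuples s n) = (coboundary z).onTuples s (n + 1) := by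
  funext v
  rw [TupleCochain.delta_apply, onTuples, coboundary_singularSimplex]
  simp only [onTuples, hs]

end singularSimplex

open TupleCochain

/-! ## Homotopy invariance of singular cohomology -/

section Homotopy

variable {Y Z : Type u} [TopologicalSpace Y] [TopologicalSpace Z] {R : Type v} [Ring R]

namespace TupleCochain

/-- The operator dual to the prism operator. -/
def prismOperator (n m : ℕ) :
    TupleCochain (stdSimplex ℝ (Fin (n + 1)) × unitInterval) R (m + 1) →+
      TupleCochain (stdSimplex ℝ (Fin (n + 1))) R m :=
  -- A constant apex would not be respected by maps of simplices, whereas the bottom copy of the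
  -- first vertex is.
  homotopy (fun _ v => (v 0, 0)) (fun _ => comap fun p => (p, 0)) (fun _ => comap fun p => (p, 1)) m

lemma delta_prismOperator (n m : ℕ)
    (ζ : TupleCochain (stdSimplex ℝ (Fin (n + 1)) × unitInterval) R (m + 1)) (hζ : delta ζ = 0) :
    delta (prismOperator n m ζ) = comap (fun p => (p, 0)) ζ - comap (fun p => (p, 1)) ζ := by
  have := homotopy_delta
    (fun _ v => (v 0, 0) : ∀ m, (Fin (m + 1) → stdSimplex ℝ (Fin (n + 1))) → _ × unitInterval)
    (φ := fun _ => comap fun p => (p, 0)) (ψ := fun _ => comap fun p => (p, 1)) (A := R)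
    (fun _ f => (delta_comap _ f).symm) (fun _ f => (delta_comap _ f).symm)
    -- In degree `0` the only tuple is the empty one, so the two ends agree there.
    (AddMonoidHom.ext fun f => funext fun v => congrArg f (Subsingleton.elim _ _)) m ζ
  rw [hζ, map_zero] at this
  exact (sub_eq_zero.1 this.symm).symm

lemma prismOperator_comap {n k : ℕ} (f : Fin (k + 1) → Fin (n + 1)) (m : ℕ)
    (ζ : TupleCochain (stdSimplex ℝ (Fin (n + 1)) × unitInterval) R (m + 1)) :
    prismOperator k m (comap (Prod.map (continuousMap f) id) ζ) =
      comap (continuousMap f) (prismOperator n m ζ) :=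
  homotopy_comap (continuousMap f) (Prod.map (continuousMap f) id) (fun _ _ => rfl) (fun _ _ => rfl) (fun _ _ => rfl) m ζ

end TupleCochain

namespace ContinuousMap.Homotopy

variable {f g : C(Y, Z)} (F : f.Homotopy g)

/-- The affine simplices in the prism over the standard simplex, mapped to `Z` by a homotopy
precomposed with a singular simplex. -/
def prismSimplex {n : ℕ} (σ : C(stdSimplex ℝ (Fin (n + 1)), Y)) (m : ℕ)
    (v : Fin (m + 1) → stdSimplex ℝ (Fin (n + 1)) × unitInterval) :
    C(stdSimplex ℝ (Fin (m + 1)), Z) :=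
  F.toContinuousMap.comp ((affineSimplex (convex_Icc (0 : ℝ) 1) (Prod.snd ∘ v)).prodMk
    (σ.comp (affineSimplex (convex_stdSimplex ℝ _) (Prod.fst ∘ v))))

lemma prismSimplex_succAbove {n : ℕ} (σ : C(stdSimplex ℝ (Fin (n + 1)), Y)) (m : ℕ)
    (v : Fin (m + 1 + 1) → stdSimplex ℝ (Fin (n + 1)) × unitInterval) (i : Fin (m + 2)) :
    F.prismSimplex σ m (v ∘ i.succAbove) =
      (F.prismSimplex σ (m + 1) v).comp (continuousMap i.succAbove) := by
  unfold prismSimplex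
  rw [← Function.comp_assoc, ← Function.comp_assoc, ← affineSimplex_comp_continuousMap,
    ← affineSimplex_comp_continuousMap]
  rfl

lemma prismSimplex_face {n k : ℕ} (σ : C(stdSimplex ℝ (Fin (n + 1)), Y))
    (f : Fin (k + 1) → Fin (n + 1)) (m : ℕ)
    (v : Fin (m + 1) → stdSimplex ℝ (Fin (k + 1)) × unitInterval) :
    F.prismSimplex (σ.comp (continuousMap f)) m v =
      F.prismSimplex σ m (Prod.map (continuousMap f) id ∘ v) := by
  unfold prismSimplex
  rw [ContinuousMap.comp_assoc, ← affineSimplex_vertices_comp, affineSimplex_comp_affineSimplex]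
  rfl

lemma prismSimplex_zero {n : ℕ} (σ : C(stdSimplex ℝ (Fin (n + 1)), Y)) :
    F.prismSimplex σ n (fun i => (vertices n i, 0)) = f.comp σ := by
  ext t
  change F (affineSimplex _ (fun _ => 0) t, σ (affineSimplex _ (vertices n) t)) = _
  rw [affineSimplex_const, affineSimplex_vertices_eq_id]
  simp

lemma prismSimplex_one {n : ℕ} (σ : C(stdSimplex ℝ (Fin (n + 1)), Y)) :
    F.prismSimplex σ n (fun i => (vertices n i, 1)) = g.comp σ := by
  ext t
  change F (affineSimplex _ (fun _ => 1) t, σ (affineSimplex _ (vertices n) t)) = _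
  rw [affineSimplex_const, affineSimplex_vertices_eq_id]
  simp

/-- The pullbacks of a cocycle along homotopic maps are cohomologous. -/
lemma exists_coboundary_eq_sub (F : f.Homotopy g)
    {z : CochainFamily (TopCat.toSSet.obj (TopCat.of Z)) R}
    (hz : z.IsFinite) (hz' : z.coboundary = 0) :
    ∃ w : CochainFamily (TopCat.toSSet.obj (TopCat.of Y)) R, w.IsFinite ∧
      w.coboundary = CochainFamily.pullback (TopCat.toSSet.map (TopCat.ofHom f)) z -
        CochainFamily.pullback (TopCat.toSSet.map (TopCat.ofHom g)) z := by
  have hδ (n m : ℕ) (σ : C(stdSimplex ℝ (Fin (n + 1)), Y)) :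
      delta (z.onTuples (F.prismSimplex σ) m) = 0 := by
    rw [z.delta_onTuples fun _ _ _ => F.prismSimplex_succAbove σ _ _ _, hz']
    rfl
  have h01 (n : ℕ) (σ : C(stdSimplex ℝ (Fin (n + 1)), Y)) :
      delta (prismOperator n n (z.onTuples (F.prismSimplex σ) n)) (vertices n) =
        z n (singularSimplex (f.comp σ)) - z n (singularSimplex (g.comp σ)) := by
    rw [delta_prismOperator _ _ _ (hδ n n σ), ← F.prismSimplex_zero, ← F.prismSimplex_one]
    rfl
  refine ⟨.ofContinuousMap fun n σ =>
    prismOperator n (n + 1) (z.onTuples (F.prismSimplex σ) (n + 1)) (vertices n), ?_, ?_⟩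
  · obtain ⟨N, hN⟩ := hz
    refine CochainFamily.isFinite_ofContinuousMap N fun n hn σ => ?_
    have : z.onTuples (F.prismSimplex σ) (n + 1) = 0 := funext fun v => hN _ (by lia) _
    rw [this, map_zero]
    rfl
  · ext n x
    obtain ⟨σ, rfl⟩ := exists_singularSimplex x
    change _ = z n (singularSimplex (f.comp σ)) - z n (singularSimplex (g.comp σ))
    rw [← h01]
    cases n with
    | zero =>
      -- The prism operator vanishes in its lowest degree, so here `h01` says that `z` agrees at the
      -- two ends of each path of the homotopy.
      change _ = delta 0 (vertices 0)
      rw [map_zero]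
      rfl
    | succ n =>
      rw [coboundary_singularSimplex, delta_apply]
      refine Finset.sum_congr rfl fun i _ => congrArg _ ?_
      -- The prism over a face sits inside the prism over `σ`, so by naturality the value of the
      -- cochain on a face is the operator for `σ` at the vertices of that face.
      have : z.onTuples (F.prismSimplex (σ.comp (continuousMap i.succAbove))) (n + 1) =
          comap (Prod.map (continuousMap i.succAbove) id)
            (z.onTuples (F.prismSimplex σ) (n + 1)) := by
        funext v
        rw [CochainFamily.onTuples, prismSimplex_face]
        rfl
      rw [CochainFamily.ofContinuousMap_singularSimplex, this, prismOperator_comap, comap_apply,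
        continuousMap_comp_vertices]

end ContinuousMap.Homotopy

/-- Homotopic maps induce the same map in singular cohomology. -/
theorem SingularCohomology.map_eq_of_homotopic {f g : C(Y, Z)} (h : f.Homotopic g) :
    SingularCohomology.map R f = SingularCohomology.map R g := by
  obtain ⟨F⟩ := h
  refine RingHom.ext fun x => ?_
  obtain ⟨z, rfl⟩ := Ideal.Quotient.mk_surjective x
  change Ideal.Quotient.mk _ _ = Ideal.Quotient.mk _ _
  rw [Ideal.Quotient.eq]
  exact F.exists_coboundary_eq_sub z.2.1 z.2.2

lemma SingularCohomology.map_comp {W : Type u} [TopologicalSpace W] (g : C(Y, Z)) (f : C(W, Y))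
    (x : SingularCohomology Z R) :
    SingularCohomology.map R (g.comp f) x =
      SingularCohomology.map R f (SingularCohomology.map R g x) := by
  obtain ⟨z, rfl⟩ := Ideal.Quotient.mk_surjective x
  rfl

end Homotopy

/-! ## Cocycles that vanish on small simplices -/

namespace CochainFamily

variable {X : Type u} [TopologicalSpace X] {R : Type v} [Ring R]

/-- A singular cochain vanishes on `A` if it vanishes on the singular simplices of `A`. -/
def VanishesOn (f : CochainFamily (TopCat.toSSet.obj (TopCat.of X)) R) (A : Set X) : Prop :=
  ∀ n (σ : C(stdSimplex ℝ (Fin (n + 1)), X)), Set.range σ ⊆ A → f n (singularSimplex σ) = 0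

/-- The values of a singular cochain on the affine simplices contained in a singular simplex. -/
abbrev onAffine (z : CochainFamily (TopCat.toSSet.obj (TopCat.of X)) R) {n : ℕ}
    (σ : C(stdSimplex ℝ (Fin (n + 1)), X)) (m : ℕ) :
    TupleCochain (stdSimplex ℝ (Fin (n + 1))) R (m + 1) :=
  z.onTuples (fun _ v => σ.comp (affineSimplex (convex_stdSimplex ℝ _) v)) m

lemma delta_onAffine {z : CochainFamily (TopCat.toSSet.obj (TopCat.of X)) R}
    (hz : z.coboundary = 0) {n : ℕ} (σ : C(stdSimplex ℝ (Fin (n + 1)), X)) (m : ℕ) :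
    delta (z.onAffine σ m) = 0 := by
  rw [onAffine, z.delta_onTuples, hz]
  · rfl
  · intro m v i
    rw [← affineSimplex_comp_continuousMap]
    rfl

lemma onAffine_comp (z : CochainFamily (TopCat.toSSet.obj (TopCat.of X)) R) {n k : ℕ}
    (σ : C(stdSimplex ℝ (Fin (n + 1)), X)) (v : Fin (k + 1) → stdSimplex ℝ (Fin (n + 1))) (m : ℕ) :
    z.onAffine (σ.comp (affineSimplex (convex_stdSimplex ℝ _) v)) m =
      comap (affineSimplex (convex_stdSimplex ℝ _) v) (z.onAffine σ m) := by
  funext u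
  rw [comap_apply]
  simp only [onAffine, onTuples, ContinuousMap.comp_assoc, affineSimplex_comp_affineSimplex]

set_option linter.unusedSectionVars false in
lemma onAffine_vertices (z : CochainFamily (TopCat.toSSet.obj (TopCat.of X)) R) {n : ℕ}
    (σ : C(stdSimplex ℝ (Fin (n + 1)), X)) :
    z.onAffine σ n (vertices n) = z n (singularSimplex σ) := by
  rw [onAffine, onTuples, affineSimplex_vertices_eq_id]
  rfl

lemma VanishesOn.onAffine_eq_zero {z : CochainFamily (TopCat.toSSet.obj (TopCat.of X)) R}
    {A : Set X} (hz : z.VanishesOn A) {n : ℕ} {σ : C(stdSimplex ℝ (Fin (n + 1)), X)}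
    (hσ : Set.range σ ⊆ A) (m : ℕ) : z.onAffine σ m = 0 :=
  funext fun _ => hz _ _ ((Set.range_comp_subset_range _ σ).trans hσ)

/-- The homotopy at `v` sees only affine simplices inside `v`: by naturality along `v` itself it can
be computed on the singular simplex cut out by `v`, where the cochain is identically zero. -/
lemma VanishesOn.subdivisionHomotopy_eq_zero
    {z : CochainFamily (TopCat.toSSet.obj (TopCat.of X)) R} {A : Set X} (hz : z.VanishesOn A)
    {n : ℕ} (σ : C(stdSimplex ℝ (Fin (n + 1)), X)) {m : ℕ}
    (v : Fin (m + 1) → stdSimplex ℝ (Fin (n + 1)))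
    (hv : Set.range (σ.comp (affineSimplex (convex_stdSimplex ℝ _) v)) ⊆ A) :
    subdivisionHomotopy (barycenter (convex_stdSimplex ℝ _)) (m + 1) (z.onAffine σ (m + 1)) v =
      0 := by
  have h := subdivisionHomotopy_comap (affineSimplex (convex_stdSimplex ℝ _) v)
    (fun _ u => affineSimplex_barycenter (convex_stdSimplex ℝ _) v u) (m + 1)
    (z.onAffine σ (m + 1))
  rw [← onAffine_comp, hz.onAffine_eq_zero hv, map_zero] at h
  have h' := congrFun h (vertices m)
  rw [comap_apply] at h'
  rw [show v = affineSimplex (convex_stdSimplex ℝ _) v ∘ vertices m from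
    funext fun i => (affineSimplex_vertices _ v i).symm]
  exact h'.symm

lemma exists_forall_dist_lt_range_subset {ι : Type*} {U : ι → Set X} (hU : ∀ i, IsOpen (U i))
    (hcov : ⋃ i, U i = Set.univ) {n : ℕ} (σ : C(stdSimplex ℝ (Fin (n + 1)), X)) :
    ∃ ε > 0, ∀ (m : ℕ) (v : Fin (m + 1) → stdSimplex ℝ (Fin (n + 1))),
      (∀ i k, dist (v i) (v k) < ε) →
        ∃ i, Set.range (σ.comp (affineSimplex (convex_stdSimplex ℝ _) v)) ⊆ U i := by
  obtain ⟨δ, hδ, h⟩ := lebesgue_number_lemma_of_metric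
    (isCompact_univ (X := stdSimplex ℝ (Fin (n + 1)))) (c := fun i => σ ⁻¹' U i)
    (fun i => (hU i).preimage σ.continuous)
    (by rw [← Set.preimage_iUnion, hcov, Set.preimage_univ])
  -- Half the Lebesgue number: the affine simplex lies in the closed ball of radius `δ / 2` about
  -- its first vertex, hence in the open ball of radius `δ`.
  refine ⟨δ / 2, half_pos hδ, fun m v hv => ?_⟩
  obtain ⟨i, hi⟩ := h (v 0) (Set.mem_univ _)
  refine ⟨i, ?_⟩
  rintro _ ⟨t, rfl⟩
  refine hi ?_
  rw [Metric.mem_ball, dist_comm]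
  exact (dist_affineSimplex_le _ v t (v 0) (δ / 2) fun k => (hv 0 k).le).trans_lt (half_lt_self hδ)

lemma eventually_iterate_subdivision_vertices {ι : Type*} {U : ι → Set X}
    (hU : ∀ i, IsOpen (U i)) (hcov : ⋃ i, U i = Set.univ) {n : ℕ}
    (σ : C(stdSimplex ℝ (Fin (n + 1)), X)) {m : ℕ}
    (f : TupleCochain (stdSimplex ℝ (Fin (n + 1))) R (m + 1))
    (hf : ∀ v i, Set.range (σ.comp (affineSimplex (convex_stdSimplex ℝ _) v)) ⊆ U i → f v = 0)
    (v : Fin (m + 1) → stdSimplex ℝ (Fin (n + 1))) :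
    ∀ᶠ j in Filter.atTop,
      (subdivision (barycenter (convex_stdSimplex ℝ _)) (m + 1))^[j] f v = 0 := by
  obtain ⟨ε, hε, h⟩ := exists_forall_dist_lt_range_subset hU hcov σ
  refine eventually_iterate_subdivision_eq_zero
    (fun n v x r hv => dist_affineSimplex_le (convex_stdSimplex ℝ _) v (center n) x r hv)
    (fun n v D hv i => dist_barycenter_le (convex_stdSimplex ℝ _) n v D hv i) m hε f
    (fun w hw => ?_) v
  obtain ⟨i, hi⟩ := h m w hw
  exact hf w i hi

/-- A singular cocycle that vanishes on all members of an open cover is a coboundary. -/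
theorem exists_coboundary_eq_of_vanishesOn_cover {ι : Type*} {U : ι → Set X}
    (hU : ∀ i, IsOpen (U i)) (hcov : ⋃ i, U i = Set.univ)
    {z : CochainFamily (TopCat.toSSet.obj (TopCat.of X)) R} (hz : z.IsFinite)
    (hz' : z.coboundary = 0) (hzU : ∀ i, z.VanishesOn (U i)) :
    ∃ w : CochainFamily (TopCat.toSSet.obj (TopCat.of X)) R, w.IsFinite ∧ w.coboundary = z := by
  let b (n : ℕ) : ∀ m, (Fin (m + 1) → stdSimplex ℝ (Fin (n + 1))) → stdSimplex ℝ (Fin (n + 1)) :=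
    barycenter (convex_stdSimplex ℝ _)
  let W {n : ℕ} (σ : C(stdSimplex ℝ (Fin (n + 1)), X)) (m j : ℕ) :
      TupleCochain (stdSimplex ℝ (Fin (n + 1))) R (m + 1) :=
    (subdivision (b n) (m + 1))^[j] (subdivisionHomotopy (b n) (m + 1) (z.onAffine σ (m + 1)))
  -- The primitive is the infinite sum over `j` of the `j`-th subdivision of the homotopy applied to
  -- `z`. On each `σ` only finitely many terms survive, though the bound `N n σ` depends on `σ`.
  have hW (n : ℕ) (σ : C(stdSimplex ℝ (Fin (n + 1)), X)) :
      ∃ N, ∀ j, N ≤ j → W σ n j (vertices n) = 0 :=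
    Filter.eventually_atTop.1 (eventually_iterate_subdivision_vertices hU hcov σ _
      (fun v i hv => (hzU i).subdivisionHomotopy_eq_zero σ v hv) (vertices n))
  choose N hN using hW
  have hsum {n : ℕ} (σ : C(stdSimplex ℝ (Fin (n + 1)), X)) (M : ℕ) (hM : N n σ ≤ M) :
      ∑ j ∈ Finset.range (N n σ), W σ n j (vertices n) =
        ∑ j ∈ Finset.range M, W σ n j (vertices n) :=
    Finset.sum_subset (Finset.range_mono hM) fun j _ hj =>
      hN n σ j (by simpa using hj)
  have hface {n : ℕ} (σ : C(stdSimplex ℝ (Fin (n + 1 + 1)), X)) (i : Fin (n + 2)) (j : ℕ) :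
      W (σ.comp (continuousMap i.succAbove)) n j (vertices n) =
        W σ n j (vertices (n + 1) ∘ i.succAbove) := by
    have hα := fun m (u : Fin (m + 1) → stdSimplex ℝ (Fin (n + 1))) =>
      affineSimplex_barycenter (convex_stdSimplex ℝ _) (vertices (n + 1) ∘ i.succAbove) u
    simp only [W]
    rw [← affineSimplex_vertices_comp, onAffine_comp, subdivisionHomotopy_comap _ hα,
      iterate_subdivision_comap _ hα, comap_apply, affineSimplex_vertices_comp,
      continuousMap_comp_vertices]
  refine ⟨.ofContinuousMap fun n σ => ∑ j ∈ Finset.range (N n σ), W σ n j (vertices n), ?_, ?_⟩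
  · obtain ⟨d, hd⟩ := hz
    refine isFinite_ofContinuousMap d fun n hn σ => Finset.sum_eq_zero fun j _ => ?_
    have : z.onAffine σ (n + 1) = 0 := funext fun v => hd _ (by lia) _
    simp only [W]
    rw [this, map_zero, iterate_map_zero]
    rfl
  · ext n x
    obtain ⟨σ, rfl⟩ := exists_singularSimplex x
    cases n with
    | zero =>
      -- A `0`-simplex is a point and lies in some `U i`, so `z` already vanishes on it.
      have hσ : σ = ContinuousMap.const _ (σ (vertices 0 0)) :=
        ContinuousMap.ext fun t => congrArg σ (Subsingleton.elim _ _)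
      obtain ⟨i, hi⟩ := Set.mem_iUnion.1 (hcov.symm ▸ Set.mem_univ (σ (vertices 0 0)))
      refine (hzU i 0 σ ?_).symm
      rw [hσ]
      rintro _ ⟨t, rfl⟩
      exact hi
    | succ n =>
      obtain ⟨M', hM'⟩ := Filter.eventually_atTop.1 (eventually_iterate_subdivision_vertices hU
        hcov σ (z.onAffine σ (n + 1)) (fun v i hv => hzU i _ _ hv) (vertices (n + 1)))
      -- `M` is large enough for the iterated subdivision of `z` to vanish on `σ` and for the sums
      -- on all faces of `σ` to be extended to a common range.
      set M := M' + ∑ i : Fin (n + 2), N n (σ.comp (continuousMap i.succAbove)) with hM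
      have hle (i : Fin (n + 2)) : N n (σ.comp (continuousMap i.succAbove)) ≤ M :=
        (Finset.single_le_sum (f := fun i : Fin (n + 2) =>
          N n (σ.comp (continuousMap i.succAbove))) (fun _ _ => Nat.zero_le _)
          (Finset.mem_univ i)).trans (Nat.le_add_left _ _)
      have key := congrFun (delta_sum_iterate_subdivisionHomotopy (b (n + 1)) (n + 1)
        (z.onAffine σ (n + 1)) (delta_onAffine hz' σ _) M) (vertices (n + 1))
      rw [Pi.sub_apply, onAffine_vertices, hM' M (Nat.le_add_right _ _), sub_zero,
        delta_apply] at key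
      rw [coboundary_singularSimplex, ← key]
      refine Finset.sum_congr rfl fun i _ => congrArg _ ?_
      rw [ofContinuousMap_singularSimplex, hsum _ M (hle i), Finset.sum_apply]
      exact Finset.sum_congr rfl fun j _ => hface σ i j

end CochainFamily

/-! ## Cohomology classes that restrict to zero and their products -/

namespace CochainFamily

variable {X : Type u} [TopologicalSpace X] {R : Type v} [Ring R]

/-- Evaluated on the affine simplices in a fixed `σ`, the coboundary becomes `delta`, so
`delta_delta` applies. -/
lemma coboundary_coboundary (w : CochainFamily (TopCat.toSSet.obj (TopCat.of X)) R) :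
    coboundary (coboundary w) = 0 := by
  have hs {n : ℕ} (σ : C(stdSimplex ℝ (Fin (n + 1)), X)) (m : ℕ)
      (v : Fin (m + 1 + 1) → stdSimplex ℝ (Fin (n + 1))) (i : Fin (m + 2)) :
      σ.comp (affineSimplex (convex_stdSimplex ℝ _) (v ∘ i.succAbove)) =
        (σ.comp (affineSimplex (convex_stdSimplex ℝ _) v)).comp (continuousMap i.succAbove) := by
    rw [← affineSimplex_comp_continuousMap]
    rfl
  ext n x
  obtain ⟨σ, rfl⟩ := exists_singularSimplex x
  cases n with
  | zero => rfl
  | succ n =>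
    refine (onAffine_vertices _ σ).symm.trans ?_
    rw [onAffine, ← delta_onTuples _ (hs σ)]
    cases n with
    | zero => exact congrFun (map_zero delta) _
    | succ n => rw [← delta_onTuples _ (hs σ), delta_delta]; rfl

/-- Front and back faces of a simplex in `A` stay in `A`, so the cochains that vanish on `A` form a
two-sided ideal. -/
lemma VanishesOn.mul_right {f : CochainFamily (TopCat.toSSet.obj (TopCat.of X)) R} {A : Set X}
    (hf : f.VanishesOn A) (g : CochainFamily (TopCat.toSSet.obj (TopCat.of X)) R) :
    (f * g).VanishesOn A := by
  intro n σ hσ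
  rw [mul_apply]
  refine Finset.sum_eq_zero fun p hp => ?_
  rw [Finset.HasAntidiagonal.mem_antidiagonal] at hp
  rw [ev_of_le f _ (by lia), map_singularSimplex, hf, zero_mul]
  exact (Set.range_comp_subset_range _ σ).trans hσ

lemma VanishesOn.mul_left {f : CochainFamily (TopCat.toSSet.obj (TopCat.of X)) R} {A : Set X}
    (hf : f.VanishesOn A) (g : CochainFamily (TopCat.toSSet.obj (TopCat.of X)) R) :
    (g * f).VanishesOn A := by
  intro n σ hσ
  rw [mul_apply]
  refine Finset.sum_eq_zero fun p hp => ?_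
  rw [Finset.HasAntidiagonal.mem_antidiagonal] at hp
  rw [ev_of_le f _ (by lia), map_singularSimplex, hf, mul_zero]
  exact (Set.range_comp_subset_range _ σ).trans hσ

lemma vanishesOn_list_prod {A : Set X}
    {l : List (cocycles (TopCat.toSSet.obj (TopCat.of X)) R)}
    (h : ∃ f ∈ l, VanishesOn f.1 A) : VanishesOn l.prod.1 A := by
  induction l with
  | nil => simp at h
  | cons g l ih =>
    rw [List.prod_cons]
    obtain ⟨f, hf, hfA⟩ := h
    rcases List.mem_cons.1 hf with rfl | hf
    · exact hfA.mul_right _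
    · exact (ih ⟨f, hf, hfA⟩).mul_left _

end CochainFamily

namespace SingularCohomology

open CochainFamily

variable {X : Type u} [TopologicalSpace X] {R : Type v} [Ring R]

/-- A class that restricts to zero on `A` is represented by a cocycle that vanishes on `A`. -/
lemma exists_vanishesOn_of_restrict_eq_zero {A : Set X} {x : SingularCohomology X R}
    (hx : restrict A R x = 0) :
    ∃ z : cocycles (TopCat.toSSet.obj (TopCat.of X)) R,
      Ideal.Quotient.mk _ z = x ∧ VanishesOn z.1 A := by
  classical
  obtain ⟨z, rfl⟩ := Ideal.Quotient.mk_surjective x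
  obtain ⟨g, ⟨N, hN⟩, hg⟩ : cocyclesMap (TopCat.toSSet.map
      (TopCat.ofHom ⟨Subtype.val, continuous_subtype_val⟩)) z ∈ coboundaries _ R :=
    Ideal.Quotient.eq_zero_iff_mem.1 hx
  -- The primitive `g` of the restriction is extended by zero to the simplices not contained in `A`;
  -- subtracting the coboundary of `w` from `z` then kills the values on `A`.
  let w : CochainFamily (TopCat.toSSet.obj (TopCat.of X)) R := .ofContinuousMap fun n σ =>
    if h : Set.range σ ⊆ A then
      g n (singularSimplex (X := A) ⟨fun t => ⟨σ t, h ⟨t, rfl⟩⟩, by fun_prop⟩) else 0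
  have hw : w.IsFinite := isFinite_ofContinuousMap N fun n hn σ => by
    split_ifs
    · exact hN n hn _
    · rfl
  have hw_apply {n : ℕ} (τ : C(stdSimplex ℝ (Fin (n + 1)), A)) :
      w n (singularSimplex (ContinuousMap.comp ⟨Subtype.val, continuous_subtype_val⟩ τ)) =
        g n (singularSimplex τ) := by
    refine (ofContinuousMap_singularSimplex _ _ _).trans ?_
    rw [dif_pos]
    · rfl
    · rintro _ ⟨t, rfl⟩
      exact (τ t).2
  let zw : cocycles (TopCat.toSSet.obj (TopCat.of X)) R :=
    ⟨coboundary w, by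
      obtain ⟨M, hM⟩ := hw
      refine ⟨M + 1, fun n hn y => ?_⟩
      cases n with
      | zero => rfl
      | succ n =>
        rw [coboundary_succ_apply]
        exact Finset.sum_eq_zero fun i _ => by rw [hM n (by lia), mul_zero],
      coboundary_coboundary w⟩
  refine ⟨z - zw, ?_, ?_⟩
  · rw [Ideal.Quotient.eq]
    refine ⟨-w, hw.neg, ?_⟩
    rw [coboundary_neg, sub_sub_cancel_left]
    rfl
  · intro n σ hσ
    obtain ⟨τ, rfl⟩ : ∃ τ : C(stdSimplex ℝ (Fin (n + 1)), A),
        σ = ContinuousMap.comp ⟨Subtype.val, continuous_subtype_val⟩ τ :=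
      ⟨⟨fun t => ⟨σ t, hσ ⟨t, rfl⟩⟩, by fun_prop⟩, rfl⟩
    have h1 : z.1 n (singularSimplex
        (ContinuousMap.comp ⟨Subtype.val, continuous_subtype_val⟩ τ)) =
        coboundary g n (singularSimplex τ) := by
      rw [hg]
      rfl
    change z.1 n _ - coboundary w n _ = 0
    rw [h1, sub_eq_zero]
    cases n with
    | zero => rfl
    | succ n =>
      rw [coboundary_singularSimplex, coboundary_singularSimplex]
      exact Finset.sum_congr rfl fun i _ => congrArg _ (hw_apply _).symm

/-- The cup-length principle: a product of classes is zero if the members of some open cover are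
such that on each of them one of the classes restricts to zero. -/
theorem list_prod_eq_zero_of_restrict_eq_zero {ι : Type*} {V : ι → Set X}
    (hV : ∀ i, IsOpen (V i)) (hcov : ⋃ i, V i = Set.univ) {k : ℕ}
    (x : Fin k → SingularCohomology X R) (j : Fin k → ι) (hj : Function.Surjective j)
    (hx : ∀ i, restrict (V (j i)) R (x i) = 0) : (List.ofFn x).prod = 0 := by
  choose z hz hzV using fun i => exists_vanishesOn_of_restrict_eq_zero (hx i)
  obtain rfl : (fun i => Ideal.Quotient.mk _ (z i)) = x := funext hz
  have h := exists_coboundary_eq_of_vanishesOn_cover hV hcov (List.ofFn z).prod.2.1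
    (List.ofFn z).prod.2.2 fun i => vanishesOn_list_prod (by
      obtain ⟨l, rfl⟩ := hj i
      exact ⟨z l, List.mem_ofFn.2 ⟨l, rfl⟩, hzV l⟩)
  have h' := Ideal.Quotient.eq_zero_iff_mem.2
    (show (List.ofFn z).prod ∈ coboundaries _ R from h)
  rw [map_list_prod, List.map_ofFn] at h'
  exact h'

end SingularCohomology

/-! ## Deformations into the diagonal of the symmetric square -/

namespace SymmetricSquare

variable {X : Type u}

lemma proj_swap (p : X × X) : proj X p.swap = proj X p :=
  (Quot.sound (r := fun p q : X × X => q = p.swap) rfl).symm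

lemma proj_eq_proj_iff {p q : X × X} : proj X p = proj X q ↔ q = p ∨ q = p.swap := by
  constructor
  · intro h
    -- The relation defining the quotient is not an equivalence relation, so equality of orbits is
    -- read off in `Sym2`.
    have h' : Sym2.mk p.1 p.2 = Sym2.mk q.1 q.2 := congrArg
      (Quot.lift (fun p : X × X => Sym2.mk p.1 p.2)
        (by rintro ⟨a, b⟩ _ rfl; exact Sym2.eq_swap)) h
    rcases Sym2.eq_iff.1 h' with ⟨h1, h2⟩ | ⟨h1, h2⟩
    · exact Or.inl (Prod.ext h1.symm h2.symm)
    · exact Or.inr (Prod.ext h2.symm h1.symm)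
  · rintro (rfl | rfl)
    · rfl
    · exact (proj_swap p).symm

lemma proj_surjective : Function.Surjective (proj X) := Quot.mk_surjective

lemma preimage_image_proj {U : Set (X × X)} (hU : Prod.swap ⁻¹' U = U) :
    proj X ⁻¹' (proj X '' U) = U := by
  refine Set.Subset.antisymm ?_ (Set.subset_preimage_image _ _)
  rintro p ⟨q, hq, hqp⟩
  rcases proj_eq_proj_iff.1 hqp with rfl | rfl
  · exact hq
  · exact hU.symm.subset hq

variable [TopologicalSpace X]

lemma continuous_proj : Continuous (proj X) := continuous_coinduced_rng

/-- Openness makes the images of the `U i` open. Unlike quotient maps in general, open ones also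
survive restriction to `V` and products with the interval. -/
lemma isOpenQuotientMap_proj : IsOpenQuotientMap (proj X) where
  surjective := proj_surjective
  continuous := continuous_proj
  isOpenMap U hU := by
    rw [isOpen_coinduced]
    have : proj X ⁻¹' (proj X '' U) = U ∪ Prod.swap ⁻¹' U := by
      ext p
      constructor
      · rintro ⟨q, hq, hqp⟩
        rcases proj_eq_proj_iff.1 hqp with rfl | rfl
        · exact Or.inl hq
        · exact Or.inr (by simpa using hq)
      · rintro (hp | hp)
        · exact ⟨p, hp, rfl⟩
        · exact ⟨p.swap, hp, proj_swap p⟩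
    rw [this]
    exact hU.union (hU.preimage continuous_swap)

/-- The map `t ↦ t / 2` of the unit interval. -/
def halve : C(unitInterval, unitInterval) where
  toFun t := ⟨(t : ℝ) / 2, by have := t.2.1; positivity, by have := t.2.2; linarith⟩
  continuous_toFun := by fun_prop

lemma halve_zero : halve 0 = 0 := Subtype.ext (zero_div 2)

lemma symm_halve_one : unitInterval.symm (halve 1) = halve 1 := by
  apply Subtype.ext
  rw [unitInterval.coe_symm_eq]
  norm_num [halve]

/-- If the preimage of `V` in `X × X` has an equivariant section, then the inclusion of `V` is
homotopic to a map into the diagonal. -/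
lemma exists_homotopic_diagonal {V : Set (SymmetricSquare X)}
    (hV : HasEquivariantSection (proj X ⁻¹' V)) :
    ∃ r : C(V, diagonal X), ContinuousMap.Homotopic
      (⟨Subtype.val, continuous_subtype_val⟩ : C(V, SymmetricSquare X))
      (ContinuousMap.comp ⟨Subtype.val, continuous_subtype_val⟩ r) := by
  obtain ⟨s, hs, hs'⟩ := hV
  have hq : IsOpenQuotientMap (Prod.map id (V.restrictPreimage (proj X)) :
      unitInterval × (proj X ⁻¹' V) → unitInterval × V) :=
    IsOpenQuotientMap.id.prodMap ⟨Set.restrictPreimage_surjective V proj_surjective,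
      continuous_proj.restrictPreimage, isOpenQuotientMap_proj.isOpenMap.restrictPreimage V⟩
  -- The points at parameters `t / 2` and `1 - t / 2` start at the ends of the path and meet at its
  -- midpoint when `t = 1`.
  let h : C(unitInterval × (proj X ⁻¹' V), SymmetricSquare X) :=
    ⟨fun a => proj X (s a.2 (halve a.1), s a.2 (unitInterval.symm (halve a.1))),
      continuous_proj.comp (by fun_prop)⟩
  have hh : ∀ a b, Prod.map id (V.restrictPreimage (proj X)) a =
      Prod.map id (V.restrictPreimage (proj X)) b → h a = h b := by
    rintro ⟨t, p⟩ ⟨t', q⟩ hab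
    obtain ⟨rfl, h2⟩ := Prod.ext_iff.1 hab
    rcases proj_eq_proj_iff.1 (congrArg Subtype.val h2) with hpq | hpq
    · obtain rfl : q = p := Subtype.ext hpq
      rfl
    · change proj X (_, _) = proj X (s q _, s q _)
      -- Reversing the path exchanges the two moving points, which leaves their orbit unchanged.
      rw [hs' p q hpq, hs' p q hpq, unitInterval.symm_symm]
      exact proj_swap (_, _)
  let H : C(unitInterval × V, SymmetricSquare X) :=
    Topology.IsQuotientMap.lift (f := ⟨_, hq.continuous⟩) hq.isQuotientMap h hh
  have hH (t : unitInterval) (p : proj X ⁻¹' V) :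
      H (t, ⟨proj X p, p.2⟩) = proj X (s p (halve t), s p (unitInterval.symm (halve t))) :=
    DFunLike.congr_fun (Topology.IsQuotientMap.lift_comp (f := ⟨_, hq.continuous⟩)
      hq.isQuotientMap h hh) (t, p)
  have hV' (y : V) : ∃ p : proj X ⁻¹' V, y = ⟨proj X p, p.2⟩ := by
    obtain ⟨y, hy⟩ := y
    obtain ⟨p, rfl⟩ := proj_surjective y
    exact ⟨⟨p, hy⟩, rfl⟩
  have h1 (y : V) : H (1, y) ∈ diagonal X := by
    obtain ⟨p, rfl⟩ := hV' y
    rw [hH, symm_halve_one]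
    exact ⟨_, rfl, rfl⟩
  have hcont : Continuous fun y : V => H (1, y) := H.continuous.comp (by fun_prop)
  refine ⟨⟨fun y => ⟨H (1, y), h1 y⟩, hcont.subtype_mk h1⟩, ⟨⟨H, fun y => ?_, fun y => rfl⟩⟩⟩
  obtain ⟨p, rfl⟩ := hV' y
  change H _ = proj X p
  rw [hH, halve_zero, unitInterval.symm_zero, hs]

end SymmetricSquare

/-- Up to homotopy the inclusion of `V` factors through the diagonal, so restriction to `V` factors
through restriction to the diagonal. -/
lemma SingularCohomology.restrict_eq_zero_of_hasEquivariantSection {X : Type u}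
    [TopologicalSpace X] {R : Type v} [Ring R] {V : Set (SymmetricSquare X)}
    (hV : HasEquivariantSection (SymmetricSquare.proj X ⁻¹' V))
    {x : SingularCohomology (SymmetricSquare X) R}
    (hx : restrict (SymmetricSquare.diagonal X) R x = 0) : restrict V R x = 0 := by
  obtain ⟨r, hr⟩ := SymmetricSquare.exists_homotopic_diagonal hV
  rw [restrict, map_eq_of_homotopic hr, map_comp]
  exact (congrArg _ hx).trans (map_zero _)

end

/-! ### The cohomological lower bound -/

theorem theorem3p4 (X : Type u) [TopologicalSpace X] (R : Type v) [Ring R] (k : ℕ)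
    (x : Fin k → SingularCohomology (SymmetricSquare X) R)
    (hx : ∀ i, SingularCohomology.restrict (SymmetricSquare.diagonal X) R (x i) = 0)
    (hprod : (List.ofFn x).prod ≠ 0) :
    (k : ℕ∞) ≤ symmetrizedTC X := by
  refine le_iInf₂ fun m hm => ?_
  by_contra! hlt
  have hmk : m < k := by exact_mod_cast hlt
  obtain ⟨U, hUo, hUs, hUc, hU⟩ := hm
  refine hprod (SingularCohomology.list_prod_eq_zero_of_restrict_eq_zero
    (V := fun i => SymmetricSquare.proj X '' U i)
    (fun i => SymmetricSquare.isOpenQuotientMap_proj.isOpenMap _ (hUo i)) ?_ x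
    -- The first `m + 1` classes are matched with the members of the cover and the surplus ones go
    -- to the last member; this is onto because `m < k`.
    (fun i => ⟨min i m, by lia⟩) (fun i => ⟨⟨i, by lia⟩, Fin.ext (min_eq_left (by simp; lia))⟩)
    fun i => ?_)
  · rw [← Set.image_iUnion, hUc, Set.image_univ, SymmetricSquare.proj_surjective.range_eq]
  · refine SingularCohomology.restrict_eq_zero_of_hasEquivariantSection ?_ (hx i)
    -- Invariance makes `U i` the full preimage of its image, so its section is a section over that
    -- preimage.
    rw [SymmetricSquare.preimage_image_proj (hUs _)]
    exact hU _
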